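/- **Setting.** Let $\mathcal M=\{\tilde M(\theta)\mid\theta\in\Theta\subseteq\mathbb R^n\}$ be a parameterized set of linear dynamic networks $$w=G(q,\theta)w+Rr+\begin{bmatrix}\tilde H(q,\theta)\\0\end{bmatrix}\tilde e,\qquad w_{\mathcal C}=Cw ,$$ with internal signals $\mathcal W=\{w_1,\dots,w_L\}$ and measured signals $\mathcal C\subseteq\mathcal W$, listed first ($C$ is the corresponding selection matrix). $R$ consists of distinct columns of the $L\times L$ identity matrix, $\tilde H$ is a $|\mathcal C|\times|\mathcal C|$ rational matrix, and $\tilde e$ is white noise with covariance $\tilde\Lambda(\theta)$. Let $\mathcal X$ be the set of all components of $r$ and $\tilde e$, and put $T=(I-G)^{-1}$, $X=\left[R\ \begin{bmatrix}\tilde H\\0\end{bmatrix}\right]$, $\Phi(\omega)=T\begin{bmatrix}\tilde H\\0\end{bmatrix}\tilde\Lambda\begin{bmatrix}\tilde H\\0\end{bmatrix}^{\star}T^{\star}$ at $z=e^{i\omega}$, and $G^\infty(\theta)=\lim_{z\to\infty}G(z,\theta)$. **Assumptions.** "Stable" means that all poles lie in $|z|<1$. A square stable transfer matrix is called minimum phase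 if it is invertible and its inverse has no poles in $|z|>1$. For every $\theta\in\Theta$: 1. $G$ is proper, stable and has zero diagonal; $T$ is stable; all principal minors of $I-G^\infty$ are nonzero; $\tilde H$ is proper, stable, monic ($\tilde H(\infty)=I$) and minimum phase; $\tilde\Lambda$ is real positive semidefinite. 2. $C\Phi(\omega)C^\top$ has full rank for almost all $\omega$. 3. $CT\begin{bmatrix}\tilde H\\0\end{bmatrix}$ is minimum phase. Moreover: 4. The entries of $G$ and $\tilde H$ are rational functions of $z$ and $\theta$, and no component of $\theta$ occurs in two different entries. (An entry that does not depend on $\theta\in\Theta$ is called known or fixed, any other entry unknown.) 5. Either $G(q,\theta)$ is strictly proper for all $\theta\in\Theta$, or $\tilde\Lambda(\theta)$ is diagonal for all $\theta\in\Theta$ and there is one permutation matrix $P$ such that $PG^\infty(\theta)P^\top$ is lower triangular for all $\theta\in\Theta$. 6. Every submatrix of $[\,G-I\ \ X\,]$ that does not depend on $\theta$ has rank equal to its structural rank, i.e. to the maximum rank of all matrices with the same nonzero pattern. **Graph.** Let $\mathcal G$ be the directed graph on $\mathcal W\cup\mathcal X$ with an edge $w_k\to w_l$ iff $G_{lk}$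 is not fixed to zero, an edge $x\to w_l$ ($x\in\mathcal X$) iff $X_{lx}$ is not fixed to zero, and no other edges; an edge is known or unknown according to its entry. Let $b_{\mathcal A\to\mathcal B}$ be the maximum number of vertex-disjoint directed paths from $\mathcal A$ to $\mathcal B$ (disjoint also in their end vertices; a single vertex is a path). Let $\mathcal X_j$ be the set of all $x\in\mathcal X$ without an unknown edge to $w_j$, let $\mathcal N_i^*$ be the set of all in-neighbors of $w_i$ in $\mathcal W$, and let $\mathcal N_j^-$ be the set of all in-neighbors of $w_j$ in $\mathcal W$ except the measured ones that have a known edge to $w_j$. **Statement.** Suppose that $w_j\in\mathcal C$ and $w_i\notin\mathcal C$, and that some $x_i\in\mathcal X$ has out-degree $1$ and a known edge to $w_i$. If for some $\bar{\mathcal X}\subseteq\mathcal X_j\setminus\{x_i\}$ and $\bar{\mathcal C}\subseteq\mathcal C$ 1. $b_{\bar{\mathcal X}\cup\{x_i\}\to\mathcal N_i^*\cup\mathcal N_j^-\cup\bar{\mathcal C}}=1+b_{\bar{\mathcal X}\cup\{x_i\}\to\mathcal N_i^*\cup(\mathcal N_j^-\setminus\{w_i\})\cup\bar{\mathcal C}}$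 and 2. $b_{\bar{\mathcal X}\cup\{x_i\}\to\mathcal N_i^*\cup(\mathcal N_j^-\setminus\{w_i\})\cup\bar{\mathcal C}}=b_{\bar{\mathcal X}\cup\{x_i\}\to\bar{\mathcal C}}$, then $G_{ji}$ is generically identifiable in $\mathcal M$ from $(w_{\mathcal C},r)$: for all $\theta_0\in\Theta$ outside a set of Lebesgue measure zero and all $\theta_1\in\Theta$, the equalities $CT(q,\theta_0)R=CT(q,\theta_1)R$ and $C\Phi(\omega,\theta_0)C^\top=C\Phi(\omega,\theta_1)C^\top$ for all $\omega$ imply $G_{ji}(q,\theta_0)=G_{ji}(q,\theta_1)$. -/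

import Mathlib

open scoped Matrix

noncomputable section

namespace DynNet

/-! ### Directed graphs and vertex disjoint paths -/

/-- `p` is the vertex sequence of a directed path of `Γ` that starts in `A` and ends in `B`. No vertex
is repeated, and a single vertex is a path from itself to itself. -/
def IsPathFromTo {V : Type} (Γ : Digraph V) (A B : Set V) (p : List V) : Prop :=
  p.IsChain Γ.Adj ∧ p.Nodup ∧ (∃ a ∈ A, p.head? = some a) ∧ (∃ b ∈ B, p.getLast? = some b)

/-- The maximum number of pairwise vertex disjoint directed paths from `A` to `B`. -/
def maxDisjointPaths {V : Type} (Γ : Digraph V) (A B : Set V) : ℕ :=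
  sSup {k : ℕ | ∃ P : Fin k → List V,
    (∀ a, IsPathFromTo Γ A B (P a)) ∧ ∀ a b, a ≠ b → (P a).Disjoint (P b)}

/-! ### Rational transfer functions

A transfer function is a rational function of the forward shift `z` (so `z⁻¹` is the delay). -/

/-- The value at a complex number (meant for points that are not poles). -/
def evalAt (z : ℂ) (f : RatFunc ℝ) : ℂ := f.eval (algebraMap ℝ ℂ) z

def IsProper (f : RatFunc ℝ) : Prop := f.num.natDegree ≤ f.denom.natDegree

/-- The limit at infinity of a proper rational function (`f.denom` is monic). -/
def atInfty (f : RatFunc ℝ) : ℝ := f.num.coeff f.denom.natDegree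

/-- Discrete-time stability: all poles lie in the open unit disc. -/
def IsStable (f : RatFunc ℝ) : Prop :=
  ∀ z : ℂ, Polynomial.aeval z f.denom = 0 → ‖z‖ < 1

/-- A square transfer matrix is minimum phase if it is invertible, is stable, and its inverse has no
pole outside the closed unit disc (zeros on the unit circle are allowed). -/
def IsMinimumPhase {ι : Type} [Fintype ι] [DecidableEq ι] (A : Matrix ι ι (RatFunc ℝ)) : Prop :=
  IsUnit A.det ∧ (∀ a b, IsStable (A a b)) ∧
    ∀ a b, ∀ z : ℂ, Polynomial.aeval z ((A⁻¹ a b).denom) = 0 → ‖z‖ ≤ 1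

/-- The structural rank: the maximum rank of all matrices with the same nonzero pattern. -/
def structuralRank {m n : Type} [Fintype m] [Fintype n] (A : Matrix m n (RatFunc ℝ)) : ℕ :=
  sSup {k : ℕ | ∃ B : Matrix m n (RatFunc ℝ), (∀ a b, B a b = 0 ↔ A a b = 0) ∧ B.rank = k}

/-- `f` is, on `Θ`, a quotient of two polynomials in `z` whose coefficients are polynomials in those
parameters `θ k` with `k ∈ S`. -/
def IsRationalIn {n : ℕ} (Θ : Set (Fin n → ℝ)) (S : Set (Fin n))
    (f : (Fin n → ℝ) → RatFunc ℝ) : Prop :=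
  ∃ N D : Polynomial (MvPolynomial (Fin n) ℝ),
    (∀ k, (↑(N.coeff k).vars : Set (Fin n)) ⊆ S) ∧
    (∀ k, (↑(D.coeff k).vars : Set (Fin n)) ⊆ S) ∧
    ∀ θ ∈ Θ, D.map (MvPolynomial.eval θ) ≠ 0 ∧
      f θ = algebraMap (Polynomial ℝ) (RatFunc ℝ) (N.map (MvPolynomial.eval θ)) /
        algebraMap (Polynomial ℝ) (RatFunc ℝ) (D.map (MvPolynomial.eval θ))

/-- A parameterized quantity is fixed (known) if it does not depend on `θ ∈ Θ`. -/
def IsFixed {n : ℕ} (Θ : Set (Fin n → ℝ)) (f : (Fin n → ℝ) → RatFunc ℝ) : Prop :=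
  ∃ c, ∀ θ ∈ Θ, f θ = c

/-- A parameterized quantity is fixed to zero. -/
def IsFixedZero {n : ℕ} (Θ : Set (Fin n → ℝ)) (f : (Fin n → ℝ) → RatFunc ℝ) : Prop :=
  ∀ θ ∈ Θ, f θ = 0

/-! ### Network model sets -/

/-- The data of a parameterized set of networks `w = G w + R r + [H; 0] e` with internal signals
`w k`, `k : Fin L`, and parameters `θ ∈ Θ ⊆ ℝⁿ`. The signals `w k` with `k ∈ measured` are measured
(these are the rows of the selection matrix `C`), the columns of `R` are the unit vectors with index in
`excited`, and the noise `e` has one component for each measured signal and covariance `Λ`; the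
unmeasured signals are free of noise. -/
structure ModelSet (L n : ℕ) where
  Θ : Set (Fin n → ℝ)
  measured : Finset (Fin L)
  excited : Finset (Fin L)
  G : (Fin n → ℝ) → Matrix (Fin L) (Fin L) (RatFunc ℝ)
  H : (Fin n → ℝ) → Matrix measured measured (RatFunc ℝ)
  Λ : (Fin n → ℝ) → Matrix measured measured ℝ

namespace ModelSet

variable {L n : ℕ} (M : ModelSet L n)

/-- The external signals: the excitations `r` and the noises `e`. -/
abbrev Ext : Type := M.excited ⊕ M.measured

/-- The selection matrix `R`. -/
def R : Matrix (Fin L) M.excited (RatFunc ℝ) :=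
  Matrix.of fun w k => if w = (k : Fin L) then 1 else 0

/-- The noise matrix `[H; 0]`. -/
def noise (θ : Fin n → ℝ) : Matrix (Fin L) M.measured (RatFunc ℝ) :=
  Matrix.of fun w k => if h : w ∈ M.measured then M.H θ ⟨w, h⟩ k else 0

/-- `X = [R [H; 0]]`. -/
def X (θ : Fin n → ℝ) : Matrix (Fin L) M.Ext (RatFunc ℝ) :=
  Matrix.fromCols M.R (M.noise θ)

/-- `T = (I - G)⁻¹`. -/
def T (θ : Fin n → ℝ) : Matrix (Fin L) (Fin L) (RatFunc ℝ) := (1 - M.G θ)⁻¹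

/-- `C A`: the rows of `A` that belong to measured signals. -/
def selC {m : Type} {K : Type} (A : Matrix (Fin L) m K) : Matrix M.measured m K :=
  A.submatrix Subtype.val id

/-- The direct feedthrough matrix `lim G(z)`, `z → ∞`. -/
def Ginfty (θ : Fin n → ℝ) : Matrix (Fin L) (Fin L) ℝ := (M.G θ).map atInfty

/-- The map `C T R` from the excitations to the measured signals. -/
def CTR (θ : Fin n → ℝ) : Matrix M.measured M.excited (RatFunc ℝ) := M.selC (M.T θ * M.R)

/-- The map `C T [H; 0]` from the noises to the measured signals. -/
def CTH (θ : Fin n → ℝ) : Matrix M.measured M.measured (RatFunc ℝ) :=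
  M.selC (M.T θ * M.noise θ)

/-- The power spectrum `Φ(ω) = T H Λ H⋆ T⋆` at `z = exp (i ω)`, with `H` short for `[H; 0]`. -/
def Φ (θ : Fin n → ℝ) (ω : ℝ) : Matrix (Fin L) (Fin L) ℂ :=
  let z : ℂ := Complex.exp (Complex.I * ω)
  let Tz := (M.T θ).map (evalAt z)
  let Hz := (M.noise θ).map (evalAt z)
  Tz * Hz * (M.Λ θ).map (algebraMap ℝ ℂ) * Hzᴴ * Tzᴴ

/-- The power spectrum `C Φ(ω) Cᵀ` of the measured signals. -/
def measuredSpectrum (θ : Fin n → ℝ) (ω : ℝ) : Matrix M.measured M.measured ℂ :=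
  (M.Φ θ ω).submatrix Subtype.val Subtype.val

/-! ### Standing assumptions -/

/-- Every member is a well-posed network model. -/
structure IsWellPosed : Prop where
  G_proper : ∀ θ ∈ M.Θ, ∀ a b, IsProper (M.G θ a b)
  G_stable : ∀ θ ∈ M.Θ, ∀ a b, IsStable (M.G θ a b)
  G_hollow : ∀ θ ∈ M.Θ, ∀ a, M.G θ a a = 0
  T_stable : ∀ θ ∈ M.Θ, ∀ a b, IsStable (M.T θ a b)
  principal_minors : ∀ θ ∈ M.Θ, ∀ S : Finset (Fin L),
    ((1 - M.Ginfty θ).submatrix (Subtype.val : S → Fin L) (Subtype.val : S → Fin L)).det ≠ 0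
  H_proper : ∀ θ ∈ M.Θ, ∀ a b, IsProper (M.H θ a b)
  H_stable : ∀ θ ∈ M.Θ, ∀ a b, IsStable (M.H θ a b)
  H_monic : ∀ θ ∈ M.Θ, (M.H θ).map atInfty = 1
  H_minimumPhase : ∀ θ ∈ M.Θ, IsMinimumPhase (M.H θ)
  Λ_posSemidef : ∀ θ ∈ M.Θ, (M.Λ θ).PosSemidef

/-- For every member, `C T [H; 0]` is a minimum phase factor of the spectrum `C Φ Cᵀ`. -/
def HasMinimumPhaseSpectralFactor : Prop :=
  ∀ θ ∈ M.Θ, IsMinimumPhase (M.CTH θ)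

/-- The measured spectrum has full rank at almost all frequencies. -/
def HasFullRankSpectrum : Prop :=
  ∀ θ ∈ M.Θ, ∀ᵐ ω : ℝ, (M.measuredSpectrum θ ω).rank = Fintype.card M.measured

/-- The entries of `G` and `H` are rational in `z` and the parameters, and no parameter is shared by two
entries. -/
def IsIndependentlyParameterized : Prop :=
  ∃ S : (Fin L × Fin L) ⊕ (M.measured × M.measured) → Set (Fin n),
    (∀ e e', e ≠ e' → Disjoint (S e) (S e')) ∧
    (∀ a b, IsRationalIn M.Θ (S (Sum.inl (a, b))) fun θ => M.G θ a b) ∧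
    ∀ a b, IsRationalIn M.Θ (S (Sum.inr (a, b))) fun θ => M.H θ a b

/-- Either `G` is strictly proper, or `Λ` is diagonal and there are no algebraic loops: simultaneous
reordering of rows and columns makes the feedthrough matrix lower triangular. -/
def HasFeedthroughCondition : Prop :=
  (∀ θ ∈ M.Θ, M.Ginfty θ = 0) ∨
  ((∀ θ ∈ M.Θ, (M.Λ θ).IsDiag) ∧
    ∃ σ : Equiv.Perm (Fin L), ∀ θ ∈ M.Θ, ∀ a b, a < b → M.Ginfty θ (σ a) (σ b) = 0)

/-- The matrix `[G - I  X]`. -/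
def GX (θ : Fin n → ℝ) : Matrix (Fin L) (Fin L ⊕ M.Ext) (RatFunc ℝ) :=
  Matrix.fromCols (M.G θ - 1) (M.X θ)

/-- Every submatrix of `[G - I  X]` that does not depend on `θ` has rank equal to its structural
rank. -/
def HasRegularFixedEntries : Prop :=
  ∀ (I : Finset (Fin L)) (J : Finset (Fin L ⊕ M.Ext)),
    (∀ a ∈ I, ∀ b ∈ J, IsFixed M.Θ fun θ => M.GX θ a b) →
    ∀ θ ∈ M.Θ,
      ((M.GX θ).submatrix (Subtype.val : I → Fin L) (Subtype.val : J → Fin L ⊕ M.Ext)).rank =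
        structuralRank
          ((M.GX θ).submatrix (Subtype.val : I → Fin L) (Subtype.val : J → Fin L ⊕ M.Ext))

/-! ### The graph of a model set -/

/-- The vertices: internal signals and external signals. -/
abbrev Vertex : Type := Fin L ⊕ M.Ext

/-- The transfer function attached to the vertex pair from `v` to the internal signal `w k`. -/
def entry (k : Fin L) : M.Vertex → (Fin n → ℝ) → RatFunc ℝ
  | Sum.inl l => fun θ => M.G θ k l
  | Sum.inr x => fun θ => M.X θ k x

/-- There is an edge from `v` to `w k` iff the corresponding entry is not fixed to zero; no edge ends in
an external signal. -/
def graph : Digraph M.Vertex where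
  Adj v v' := ∃ k : Fin L, v' = Sum.inl k ∧ ¬ IsFixedZero M.Θ (M.entry k v)

/-- There is an edge from `v` to `w k`, and it is known. -/
def KnownEdge (v : M.Vertex) (k : Fin L) : Prop :=
  M.graph.Adj v (Sum.inl k) ∧ IsFixed M.Θ (M.entry k v)

/-- There is an edge from `v` to `w k`, and it is unknown. -/
def UnknownEdge (v : M.Vertex) (k : Fin L) : Prop :=
  M.graph.Adj v (Sum.inl k) ∧ ¬ IsFixed M.Θ (M.entry k v)

/-- The number of out-neighbors. -/
def outDegree (v : M.Vertex) : ℕ := {v' | M.graph.Adj v v'}.ncard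

/-- `X_j`: the external signals without unknown edge to `w j`. -/
def extNoUnknown (j : Fin L) : Set M.Ext := {x | ¬ M.UnknownEdge (Sum.inr x) j}

/-- `N_i^*`: all in-neighbors of `w i` among the internal signals. -/
def inNbrs (i : Fin L) : Set (Fin L) := {k | M.graph.Adj (Sum.inl k) (Sum.inl i)}

/-- `N_j^-`: the in-neighbors of `w j` among the internal signals, except the measured ones with a known
edge to `w j`. -/
def inNbrsMinus (j : Fin L) : Set (Fin L) :=
  {k ∈ M.inNbrs j | ¬ (k ∈ M.measured ∧ M.KnownEdge (Sum.inl k) j)}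

/-- `b_{A → B}`, for a set `A` of external and a set `B` of internal signals. -/
def b (A : Set M.Ext) (B : Set (Fin L)) : ℕ :=
  maxDisjointPaths M.graph (Sum.inr '' A) (Sum.inl '' B)

/-! ### Identifiability -/

/-- At `θ₀` the module `G_{ji}` is determined within the model set by `C T R` and `C Φ Cᵀ`. -/
def IdentifiableAt (j i : Fin L) (θ₀ : Fin n → ℝ) : Prop :=
  ∀ θ₁ ∈ M.Θ, M.CTR θ₀ = M.CTR θ₁ →
    (∀ ω : ℝ, M.measuredSpectrum θ₀ ω = M.measuredSpectrum θ₁ ω) →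
    M.G θ₀ j i = M.G θ₁ j i

/-- The module `G_{ji}` is identifiable at all `θ₀ ∈ Θ` outside a set of Lebesgue measure zero. -/
def GenericallyIdentifiable (j i : Fin L) : Prop :=
  MeasureTheory.volume {θ₀ ∈ M.Θ | ¬ M.IdentifiableAt j i θ₀} = 0

end ModelSet

end DynNet

end

noncomputable section

/-! ### Generic nonvanishing of rational functions of the parameters -/

namespace DynNet

open MeasureTheory

/-! Call the row of `T X` at `w k`, restricted to the columns in A = X̄ ∪ {x_i}, the response of `w
k`. Three facts carry the proof.

Data determine measured responses. `C T [H; 0]` is a stable factor of the measured spectrum whose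
inverse has no poles outside the closed disc. Two such factors of one full rank spectrum differ by a
constant matrix V (`exists_eq_mul_C_of_spectrum_eq`). The limits at infinity and the feedthrough
condition force V = 1 (`CTH_eq_of_spectrum_eq`), so indistinguishable models share all rows of `C T
X`.

Rank counts disjoint paths. The span of the responses of B has dimension at most b_{A → B} at every
θ ∈ Θ (`responseRank_le`), and exactly this dimension for almost every θ ∈ Θ (`ae_le_responseRank`).
The link is [G - I X] = (I - G) [-I T X]: a minor of `T X` is nonzero iff a corresponding L × L
minor of the sparse matrix [G - I X] is, and the transversals of the latter are systems of disjoint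
paths. A nonzero minor has a nonzero term in its Leibniz expansion, hence a transversal. Conversely,
a transversal makes the minor generically nonzero by `ae_det_ne_zero_of_transversal`, where
independent parameters and the rank assumption on fixed submatrices enter.

Duality. Let B = N_i^* ∪ (N_j^- \ {w_i}) ∪ C̄. For generic θ₀, condition 1 says that the response of
w_i is outside the span of those of B, so some functional φ kills the latter but not the former. By
condition 2, the responses of B at the arbitrary θ₁ are spanned by those of C̄; these are data, so φ
kills the responses of B at θ₁ too. Applying φ to rows i and j of the network equation leaves
G_{ji}(θ₀) c = G_{ji}(θ₁) c with c ≠ 0 (`G_eq_of_dual`). -/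

theorem ae_eval_ne_zero {n : ℕ} (p : MvPolynomial (Fin n) ℝ) (hp : p ≠ 0) :
    ∀ᵐ x : Fin n → ℝ, MvPolynomial.eval x p ≠ 0 := by
  induction n with
  | zero =>
    refine Filter.Eventually.of_forall fun x hx => hp ?_
    refine MvPolynomial.funext fun y => ?_
    rw [Subsingleton.elim y x, hx, map_zero]
  | succ n ih =>
    have hq : MvPolynomial.finSuccEquiv ℝ n p ≠ 0 := by simpa using hp
    set q := MvPolynomial.finSuccEquiv ℝ n p with hqdef
    have hlead := ih q.leadingCoeff (by simpa using hq)
    have hmp := volume_preserving_piFinSuccAbove (fun _ : Fin (n + 1) => ℝ) 0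
    set e := MeasurableEquiv.piFinSuccAbove (fun _ : Fin (n + 1) => ℝ) 0
    have hval : ∀ x : Fin (n + 1) → ℝ, MvPolynomial.eval x p =
        Polynomial.eval (e x).1 (q.map (MvPolynomial.eval (e x).2)) := by
      intro x
      have := MvPolynomial.eval_eq_eval_mv_eval' (e x).2 (e x).1 p
      rw [← this]
      congr 1
      congr 1
      exact (Fin.cons_self_tail x).symm
    have hmeas : MeasurableSet {y : ℝ × (Fin n → ℝ) |
        ¬ Polynomial.eval y.1 (q.map (MvPolynomial.eval y.2)) ≠ 0} := by
      have hc : Continuous fun y : ℝ × (Fin n → ℝ) =>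
          Polynomial.eval y.1 (q.map (MvPolynomial.eval y.2)) := by
        have : (fun y : ℝ × (Fin n → ℝ) => Polynomial.eval y.1 (q.map (MvPolynomial.eval y.2))) =
            fun y => MvPolynomial.eval (Fin.cons y.1 y.2 : Fin (n + 1) → ℝ) p := by
          funext y
          exact (MvPolynomial.eval_eq_eval_mv_eval' y.2 y.1 p).symm
        rw [this]
        refine (MvPolynomial.continuous_eval p).comp ?_
        refine continuous_pi fun k => ?_
        refine Fin.cases ?_ (fun k => ?_) k
        · simpa using continuous_fst
        · simp only [Fin.cons_succ]
          exact (continuous_apply k).comp continuous_snd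
      simpa using (isClosed_eq hc continuous_const).measurableSet
    -- Fubini: wherever the leading coefficient in the first variable is nonzero, the slice of the
    -- zero set is a finite set of roots.
    have hprod : ∀ᵐ y : ℝ × (Fin n → ℝ),
        Polynomial.eval y.1 (q.map (MvPolynomial.eval y.2)) ≠ 0 := by
      rw [ae_iff, Measure.volume_eq_prod, Measure.prod_apply_symm hmeas]
      refine (lintegral_congr_ae ?_).trans lintegral_zero
      filter_upwards [hlead] with y hy
      refine Set.Finite.measure_zero ?_ _
      have hne : q.map (MvPolynomial.eval y) ≠ 0 := fun h => hy <| by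
        have := congrArg (fun r => Polynomial.coeff r q.natDegree) h
        simpa using this
      refine (q.map (MvPolynomial.eval y)).roots.toFinset.finite_toSet.subset fun x hx => ?_
      simpa [hne, Polynomial.IsRoot] using hx
    have := hmp.quasiMeasurePreserving.ae hprod
    filter_upwards [this] with x hx
    rw [hval]
    exact hx

theorem ae_map_eval_ne_zero {n : ℕ} (P : Polynomial (MvPolynomial (Fin n) ℝ)) (hP : P ≠ 0) :
    ∀ᵐ θ : Fin n → ℝ, P.map (MvPolynomial.eval θ) ≠ 0 := by
  filter_upwards [ae_eval_ne_zero P.leadingCoeff (by simpa using hP)] with θ hθ h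
  apply hθ
  have := congrArg (fun q => Polynomial.coeff q P.natDegree) h
  simpa using this

/-- The polynomials in `z` whose coefficients only involve the parameters in `S`. -/
def paramSubring {n : ℕ} (S : Set (Fin n)) : Subring (Polynomial (MvPolynomial (Fin n) ℝ)) where
  carrier := {N | ∀ k, N.coeff k ∈ MvPolynomial.supported ℝ S}
  mul_mem' := fun {a b} ha hb k => by
    rw [Polynomial.coeff_mul]
    exact Subalgebra.sum_mem _ fun x _ => Subalgebra.mul_mem _ (ha _) (hb _)
  one_mem' := fun k => by
    rw [Polynomial.coeff_one]
    split_ifs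
    · exact Subalgebra.one_mem _
    · exact Subalgebra.zero_mem _
  add_mem' := fun {a b} ha hb k => by
    rw [Polynomial.coeff_add]
    exact Subalgebra.add_mem _ (ha _) (hb _)
  zero_mem' := fun k => by simp
  neg_mem' := fun {a} ha k => by
    rw [Polynomial.coeff_neg]
    exact Subalgebra.neg_mem _ (ha _)

theorem map_eval_congr {n : ℕ} {S : Set (Fin n)} {N : Polynomial (MvPolynomial (Fin n) ℝ)}
    (hN : N ∈ paramSubring S) {θ θ' : Fin n → ℝ} (h : ∀ k ∈ S, θ k = θ' k) :
    N.map (MvPolynomial.eval θ) = N.map (MvPolynomial.eval θ') := by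
  ext k
  rw [Polynomial.coeff_map, Polynomial.coeff_map]
  have := MvPolynomial.mem_supported.1 (hN k)
  exact MvPolynomial.eval₂Hom_congr' rfl (fun i hi _ => h i (this hi)) rfl

section Rational

variable {n : ℕ} {Θ : Set (Fin n → ℝ)} {S S' : Set (Fin n)} {f g : (Fin n → ℝ) → RatFunc ℝ}

theorem isRationalIn_iff : IsRationalIn Θ S f ↔ ∃ N ∈ paramSubring S, ∃ D ∈ paramSubring S,
    ∀ θ ∈ Θ, D.map (MvPolynomial.eval θ) ≠ 0 ∧
      f θ = algebraMap (Polynomial ℝ) (RatFunc ℝ) (N.map (MvPolynomial.eval θ)) /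
        algebraMap (Polynomial ℝ) (RatFunc ℝ) (D.map (MvPolynomial.eval θ)) := by
  constructor
  · rintro ⟨N, D, hN, hD, h⟩
    exact ⟨N, fun k => MvPolynomial.mem_supported.2 (hN k), D,
      fun k => MvPolynomial.mem_supported.2 (hD k), h⟩
  · rintro ⟨N, hN, D, hD, h⟩
    exact ⟨N, D, fun k => MvPolynomial.mem_supported.1 (hN k),
      fun k => MvPolynomial.mem_supported.1 (hD k), h⟩

theorem IsRationalIn.mono (hf : IsRationalIn Θ S f) (h : S ⊆ S') : IsRationalIn Θ S' f := by
  obtain ⟨N, D, hN, hD, h'⟩ := hf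
  exact ⟨N, D, fun k => (hN k).trans h, fun k => (hD k).trans h, h'⟩

theorem IsRationalIn.congr (hf : IsRationalIn Θ S f) (h : ∀ θ ∈ Θ, g θ = f θ) :
    IsRationalIn Θ S g := by
  obtain ⟨N, D, hN, hD, h'⟩ := hf
  exact ⟨N, D, hN, hD, fun θ hθ => ⟨(h' θ hθ).1, (h θ hθ).trans (h' θ hθ).2⟩⟩

theorem isRationalIn_const (c : RatFunc ℝ) : IsRationalIn Θ S fun _ => c := by
  have key : ∀ p : Polynomial ℝ, p.map (MvPolynomial.C (σ := Fin n)) ∈ paramSubring S := by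
    intro p k
    rw [Polynomial.coeff_map]
    exact Subalgebra.algebraMap_mem _ _
  have hid : ∀ (p : Polynomial ℝ) (θ : Fin n → ℝ),
      (p.map (MvPolynomial.C (σ := Fin n))).map (MvPolynomial.eval θ) = p := by
    intro p θ
    ext k
    simp
  refine isRationalIn_iff.2 ⟨_, key c.num, _, key c.denom, fun θ _ => ?_⟩
  rw [hid, hid]
  exact ⟨c.denom_ne_zero, (RatFunc.num_div_denom c).symm⟩

theorem IsRationalIn.mul (hf : IsRationalIn Θ S f) (hg : IsRationalIn Θ S g) :
    IsRationalIn Θ S fun θ => f θ * g θ := by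
  obtain ⟨N, hN, D, hD, h⟩ := isRationalIn_iff.1 hf
  obtain ⟨N', hN', D', hD', h'⟩ := isRationalIn_iff.1 hg
  refine isRationalIn_iff.2 ⟨N * N', mul_mem hN hN', D * D', mul_mem hD hD', fun θ hθ => ?_⟩
  rw [Polynomial.map_mul, Polynomial.map_mul]
  refine ⟨mul_ne_zero (h θ hθ).1 (h' θ hθ).1, ?_⟩
  rw [(h θ hθ).2, (h' θ hθ).2, map_mul, map_mul, div_mul_div_comm]

theorem IsRationalIn.add (hf : IsRationalIn Θ S f) (hg : IsRationalIn Θ S g) :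
    IsRationalIn Θ S fun θ => f θ + g θ := by
  obtain ⟨N, hN, D, hD, h⟩ := isRationalIn_iff.1 hf
  obtain ⟨N', hN', D', hD', h'⟩ := isRationalIn_iff.1 hg
  refine isRationalIn_iff.2 ⟨N * D' + D * N', add_mem (mul_mem hN hD') (mul_mem hD hN'),
    D * D', mul_mem hD hD', fun θ hθ => ?_⟩
  simp only [Polynomial.map_mul, Polynomial.map_add]
  refine ⟨mul_ne_zero (h θ hθ).1 (h' θ hθ).1, ?_⟩
  rw [(h θ hθ).2, (h' θ hθ).2, map_add, map_mul, map_mul, map_mul, div_add_div]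
  · simpa using (h θ hθ).1
  · simpa using (h' θ hθ).1

theorem IsRationalIn.sum {ι : Type*} (s : Finset ι) {F : ι → (Fin n → ℝ) → RatFunc ℝ}
    (h : ∀ a ∈ s, IsRationalIn Θ S (F a)) : IsRationalIn Θ S fun θ => ∑ a ∈ s, F a θ := by
  classical
  induction s using Finset.induction_on with
  | empty => simpa using isRationalIn_const 0
  | insert a s ha ih =>
    simp only [Finset.sum_insert ha]
    exact (h a (Finset.mem_insert_self _ _)).add
      (ih fun b hb => h b (Finset.mem_insert_of_mem hb))

theorem IsRationalIn.prod {ι : Type*} (s : Finset ι) {F : ι → (Fin n → ℝ) → RatFunc ℝ}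
    (h : ∀ a ∈ s, IsRationalIn Θ S (F a)) : IsRationalIn Θ S fun θ => ∏ a ∈ s, F a θ := by
  classical
  induction s using Finset.induction_on with
  | empty => simpa using isRationalIn_const 1
  | insert a s ha ih =>
    simp only [Finset.prod_insert ha]
    exact (h a (Finset.mem_insert_self _ _)).mul
      (ih fun b hb => h b (Finset.mem_insert_of_mem hb))

theorem IsRationalIn.det {ι : Type*} [Fintype ι] [DecidableEq ι]
    {A : (Fin n → ℝ) → Matrix ι ι (RatFunc ℝ)}
    (h : ∀ a b, IsRationalIn Θ S fun θ => A θ a b) : IsRationalIn Θ S fun θ => (A θ).det := by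
  simp only [Matrix.det_apply']
  exact IsRationalIn.sum _ fun σ _ => (isRationalIn_const _).mul
    (IsRationalIn.prod _ fun a _ => h _ _)

/-- The numerator decides, as the denominator does not vanish on Θ. No regularity of Θ, not even
measurability, enters. -/
theorem IsRationalIn.eq_zero_or_ae_ne_zero (hf : IsRationalIn Θ S f) :
    (∀ θ ∈ Θ, f θ = 0) ∨ ∀ᵐ θ, θ ∈ Θ → f θ ≠ 0 := by
  obtain ⟨N, hN, D, hD, h⟩ := isRationalIn_iff.1 hf
  by_cases hN0 : N = 0
  · left
    intro θ hθ
    rw [(h θ hθ).2, hN0]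
    simp
  · right
    filter_upwards [ae_map_eval_ne_zero N hN0] with θ hθ hmem
    rw [(h θ hmem).2]
    refine div_ne_zero ?_ ?_
    · simpa using hθ
    · simpa using (h θ hmem).1

/-- An affine function of a non-fixed entry whose coefficients do not share parameters with the
entry is generically nonzero, provided that the leading coefficient is. -/
theorem ae_mul_add_ne_zero {u c r : (Fin n → ℝ) → RatFunc ℝ} (hu : IsRationalIn Θ S u)
    (hc : IsRationalIn Θ S' c) (hr : IsRationalIn Θ S' r) (hS : Disjoint S S')
    (hfix : ¬ IsFixed Θ u) (hc0 : ∀ᵐ θ, θ ∈ Θ → c θ ≠ 0) :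
    ∀ᵐ θ, θ ∈ Θ → u θ * c θ + r θ ≠ 0 := by
  classical
  have hall : IsRationalIn Θ (S ∪ S') fun θ => u θ * c θ + r θ :=
    ((hu.mono Set.subset_union_left).mul (hc.mono Set.subset_union_right)).add
      (hr.mono Set.subset_union_right)
  rcases hall.eq_zero_or_ae_ne_zero with h0 | h0
  swap
  · exact h0
  -- The claim is vacuous for a null set Θ. Otherwise every generic property holds at some point of
  -- Θ.
  by_cases hnull : ∀ᵐ θ, θ ∉ Θ
  · filter_upwards [hnull] with θ hθ hmem using absurd hmem hθ
  exfalso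
  have hex : ∀ {p : (Fin n → ℝ) → Prop}, (∀ᵐ θ, θ ∈ Θ → p θ) → ∃ θ ∈ Θ, p θ := by
    intro p hp
    by_contra hcon
    push Not at hcon
    apply hnull
    filter_upwards [hp] with θ hθ hmem using hcon θ hmem (hθ hmem)
  obtain ⟨Nu, hNu, Du, hDu, hu'⟩ := isRationalIn_iff.1 hu
  obtain ⟨Nc, hNc, Dc, hDc, hc'⟩ := isRationalIn_iff.1 hc
  obtain ⟨Nr, hNr, Dr, hDr, hr'⟩ := isRationalIn_iff.1 hr
  -- A polynomial vanishing on a non-null set is zero, so the relation with cleared denominators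
  -- holds for all parameter values, also outside Θ.
  have hE : Nu * Nc * Dr + Nr * Du * Dc = 0 := by
    by_contra hne
    obtain ⟨θ, hθ, h⟩ := hex ((ae_map_eval_ne_zero _ hne).mono fun θ h _ => h)
    apply h
    have h1 := h0 θ hθ
    simp only [(hu' θ hθ).2, (hc' θ hθ).2, (hr' θ hθ).2] at h1
    have d1 := (RatFunc.algebraMap_ne_zero (hu' θ hθ).1)
    have d2 := (RatFunc.algebraMap_ne_zero (hc' θ hθ).1)
    have d3 := (RatFunc.algebraMap_ne_zero (hr' θ hθ).1)
    field_simp at h1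
    apply RatFunc.algebraMap_injective ℝ
    simp only [Polynomial.map_add, Polynomial.map_mul, map_add, map_mul, map_zero]
    linear_combination h1
  obtain ⟨θ', hθ', hcθ'⟩ := hex hc0
  apply hfix
  refine ⟨-r θ' / c θ', fun θ hθ => ?_⟩
  -- The mixed point η may leave Θ, but the polynomial identity persists there. It expresses `u θ`
  -- through `c θ'` and `r θ'` with θ' held fixed, so `u` would be constant on Θ.
  set η : Fin n → ℝ := fun k => if k ∈ S then θ k else θ' k with hη
  have e1 : ∀ k ∈ S, η k = θ k := fun k hk => by simp [hη, hk]
  have e2 : ∀ k ∈ S', η k = θ' k := fun k hk => by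
    have : k ∉ S := fun h => Set.disjoint_left.1 hS h hk
    simp [hη, this]
  have h1 := congrArg (Polynomial.map (MvPolynomial.eval η)) hE
  simp only [Polynomial.map_add, Polynomial.map_mul, Polynomial.map_zero] at h1
  rw [map_eval_congr hNu e1, map_eval_congr hDu e1, map_eval_congr hNc e2,
    map_eval_congr hDc e2, map_eval_congr hNr e2, map_eval_congr hDr e2] at h1
  have h2 := congrArg (algebraMap (Polynomial ℝ) (RatFunc ℝ)) h1
  simp only [map_add, map_mul, map_zero] at h2
  rw [eq_div_iff hcθ']
  rw [(hu' θ hθ).2, (hc' θ' hθ').2, (hr' θ' hθ').2]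
  have d1 := (RatFunc.algebraMap_ne_zero (hu' θ hθ).1)
  have d2 := (RatFunc.algebraMap_ne_zero (hc' θ' hθ').1)
  have d3 := (RatFunc.algebraMap_ne_zero (hr' θ' hθ').1)
  field_simp
  linear_combination h2

end Rational

end DynNet

/-! ### Generic nonsingularity of matrices with fixed and free entries -/

namespace DynNet

open MeasureTheory

section Mixed

variable {n : ℕ} {Θ : Set (Fin n → ℝ)} {m κ : Type} {A : m → κ → (Fin n → ℝ) → RatFunc ℝ}
  {S : m → κ → Set (Fin n)}

theorem det_updateRow_single {ι : Type*} [Fintype ι] [DecidableEq ι] {K : Type*} [CommRing K]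
    (M : Matrix ι ι K) (a₀ : ι) :
    (M.updateRow a₀ (Pi.single a₀ 1)).det =
      (M.submatrix (Subtype.val : {a // a ≠ a₀} → ι) Subtype.val).det := by
  rw [Matrix.twoBlockTriangular_det _ (fun a => a ≠ a₀)]
  · have : Unique {a // ¬ a ≠ a₀} := ⟨⟨⟨a₀, by simp⟩⟩, fun x => Subtype.ext (not_not.1 x.2)⟩
    have hd : ((default : {a // ¬ a ≠ a₀}) : ι) = a₀ := not_not.1 (default : {a // ¬ a ≠ a₀}).2
    have h1 : ((M.updateRow a₀ (Pi.single a₀ 1)).toSquareBlockProp fun a => ¬ a ≠ a₀).det = 1 := by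
      rw [Matrix.det_unique, Matrix.toSquareBlockProp_def, Matrix.of_apply, hd]
      simp
    rw [h1, mul_one]
    congr 1
    ext a b
    change (M.updateRow a₀ (Pi.single a₀ 1)) a b = M a b
    rw [Matrix.updateRow_ne a.2]
  · intro a ha b hb
    obtain rfl := not_not.1 ha
    simp [hb]

/-- Expansion along row `a₀` makes the determinant affine in the unknown entry. The coefficient of
that entry is the complementary minor, and all remaining terms use only the parameters of other
entries. -/
theorem ae_det_ne_zero_of_unknown_diagonal
    (hS : ∀ a b a' b', (a, b) ≠ (a', b') → Disjoint (S a b) (S a' b'))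
    (hA : ∀ a b, IsRationalIn Θ (S a b) (A a b))
    {ι : Type} [Fintype ι] [DecidableEq ι] {r : ι → m} {c : ι → κ} (hr : r.Injective)
    (hc : c.Injective) (a₀ : ι) (hunk : ¬ IsFixed Θ (A (r a₀) (c a₀)))
    (hminor : ∀ᵐ θ, θ ∈ Θ →
      (Matrix.of fun a b : {a // a ≠ a₀} => A (r a) (c b) θ).det ≠ 0) :
    ∀ᵐ θ, θ ∈ Θ → (Matrix.of fun a b => A (r a) (c b) θ).det ≠ 0 := by
  set M : (Fin n → ℝ) → Matrix ι ι (RatFunc ℝ) :=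
    fun θ => Matrix.of fun a b => A (r a) (c b) θ with hM
  set S' : Set (Fin n) := ⋃ p : {p : ι × ι // p ≠ (a₀, a₀)}, S (r p.1.1) (c p.1.2) with hS'
  have hmem : ∀ a b, (a, b) ≠ (a₀, a₀) → S (r a) (c b) ⊆ S' := fun a b h =>
    Set.subset_iUnion (fun p : {p : ι × ι // p ≠ (a₀, a₀)} => S (r p.1.1) (c p.1.2)) ⟨(a, b), h⟩
  have hdisj : Disjoint (S (r a₀) (c a₀)) S' := by
    rw [hS', Set.disjoint_iUnion_right]
    rintro ⟨⟨a, b⟩, hab⟩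
    refine hS _ _ _ _ fun h => hab ?_
    rw [Prod.mk.injEq] at h ⊢
    exact ⟨(hr h.1).symm, (hc h.2).symm⟩
  have hadj : ∀ b, IsRationalIn Θ S' fun θ => (M θ).adjugate b a₀ := by
    intro b
    simp only [Matrix.adjugate_apply]
    refine IsRationalIn.det fun a b' => ?_
    by_cases ha : a = a₀
    · subst ha
      simp only [Matrix.updateRow_self]
      exact isRationalIn_const _
    · simp only [Matrix.updateRow_ne ha]
      exact (hA (r a) (c b')).mono (hmem a b' fun h => ha (Prod.mk.inj h).1)
  have hdet : ∀ θ, (M θ).det = A (r a₀) (c a₀) θ * (M θ).adjugate a₀ a₀ +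
      ∑ b ∈ Finset.univ.erase a₀, A (r a₀) (c b) θ * (M θ).adjugate b a₀ := by
    intro θ
    rw [Matrix.det_eq_sum_mul_adjugate_row _ a₀,
      ← Finset.add_sum_erase _ _ (Finset.mem_univ a₀)]
    rfl
  change ∀ᵐ θ, θ ∈ Θ → (M θ).det ≠ 0
  simp only [hdet]
  refine ae_mul_add_ne_zero (hA _ _) (hadj _) (IsRationalIn.sum _ fun b hb => ?_) hdisj hunk ?_
  · exact ((hA _ _).mono (hmem _ _ fun h =>
      (Finset.ne_of_mem_erase hb) (Prod.mk.inj h).2)).mul (hadj b)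
  · filter_upwards [hminor] with θ hθ hmem
    rw [Matrix.adjugate_apply, det_updateRow_single]
    exact hθ hmem

/-- A generic matrix whose fully fixed submatrices are nonsingular as soon as they have a
transversal is itself generically nonsingular as soon as it has a transversal. -/
theorem ae_det_ne_zero_of_transversal
    (hS : ∀ a b a' b', (a, b) ≠ (a', b') → Disjoint (S a b) (S a' b'))
    (hA : ∀ a b, IsRationalIn Θ (S a b) (A a b))
    (hfix : ∀ (ι : Type) [Fintype ι] [DecidableEq ι] (r : ι → m) (c : ι → κ), r.Injective →
      c.Injective → (∀ a b, IsFixed Θ (A (r a) (c b))) →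
      (∀ a, ¬ IsFixedZero Θ (A (r a) (c a))) →
      ∀ θ ∈ Θ, (Matrix.of fun a b => A (r a) (c b) θ).det ≠ 0)
    {ι : Type} [Fintype ι] [DecidableEq ι] {r : ι → m} {c : ι → κ} (hr : r.Injective)
    (hc : c.Injective) (hdiag : ∀ a, ¬ IsFixedZero Θ (A (r a) (c a))) :
    ∀ᵐ θ, θ ∈ Θ → (Matrix.of fun a b => A (r a) (c b) θ).det ≠ 0 := by
  suffices H : ∀ (N : ℕ) (ι : Type) [Fintype ι] [DecidableEq ι] (r : ι → m) (c : ι → κ),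
      Fintype.card ι = N → r.Injective → c.Injective →
      (∀ a, ¬ IsFixedZero Θ (A (r a) (c a))) →
      ∀ᵐ θ, θ ∈ Θ → (Matrix.of fun a b => A (r a) (c b) θ).det ≠ 0 from
    H _ ι r c rfl hr hc hdiag
  intro N
  induction N using Nat.strong_induction_on with
  | _ N ih =>
  intro ι _ _ r c hN hr hc hdiag
  subst hN
  classical
  -- Reducible case: a zero block makes the matrix block triangular, and both smaller diagonal
  -- blocks inherit the diagonal as a transversal.
  by_cases hclosed : ∃ U : Finset ι, U.Nonempty ∧ U ≠ Finset.univ ∧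
      ∀ a ∈ U, ∀ b ∉ U, IsFixedZero Θ (A (r a) (c b))
  · obtain ⟨U, hne, huniv, hU⟩ := hclosed
    have key : ∀ (p : ι → Prop) [DecidablePred p], (∃ a, ¬ p a) → ∀ᵐ θ, θ ∈ Θ →
        (Matrix.of fun a b : {a // p a} => A (r a) (c b) θ).det ≠ 0 := by
      rintro p _ ⟨a, ha⟩
      exact ih (Fintype.card {a // p a}) (Fintype.card_subtype_lt ha) {a // p a} (fun a => r a.1)
        (fun a => c a.1) rfl (hr.comp Subtype.val_injective) (hc.comp Subtype.val_injective)
        (fun a => hdiag a.1)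
    have hne' : ∃ a, ¬ a ∈ U := by
      by_contra hcon
      push Not at hcon
      exact huniv (Finset.eq_univ_of_forall hcon)
    filter_upwards [key (fun a => a ∈ U) hne',
      key (fun a => ¬ a ∈ U) (by obtain ⟨a, ha⟩ := hne; exact ⟨a, by simpa using ha⟩)]
      with θ h1 h2 hθ
    rw [Matrix.twoBlockTriangular_det' _ (fun a => a ∈ U)]
    · exact mul_ne_zero (h1 hθ) (h2 hθ)
    · intro a ha b hb
      exact hU a ha b hb θ hθ
  by_cases hall : ∀ a b, IsFixed Θ (A (r a) (c b))
  · exact Filter.Eventually.of_forall (hfix ι r c hr hc hall hdiag)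
  push Not at hall hclosed
  obtain ⟨a₀, b₀, hunk⟩ := hall
  have hunk0 : ¬ IsFixedZero Θ (A (r a₀) (c b₀)) := fun h => hunk ⟨0, h⟩
  -- Without row `a₀` and column `b₀` a transversal remains, by Hall. A nonempty set of s remaining
  -- rows meets its own s diagonal columns and, by irreducibility, a further column outside them, so
  -- losing `b₀` leaves at least s.
  let t : {a // a ≠ a₀} → Finset ι := fun a =>
    Finset.univ.filter fun b => b ≠ b₀ ∧ ¬ IsFixedZero Θ (A (r a) (c b))
  obtain ⟨f, hfinj, hft⟩ :=
    (Finset.all_card_le_biUnion_card_iff_exists_injective t).1 (by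
      intro s
      rcases s.eq_empty_or_nonempty with rfl | hs
      · simp
      set U : Finset ι := s.map (Function.Embedding.subtype _) with hUdef
      have ha₀U : a₀ ∉ U := by simp [hUdef]
      obtain ⟨a, ha, b, hb, hab⟩ := hclosed U (by simpa [hUdef] using hs)
        (fun h => ha₀U (h ▸ Finset.mem_univ _))
      have hsub : (insert b U).erase b₀ ⊆ s.biUnion t := by
        intro x hx
        obtain ⟨hx0, hx⟩ := Finset.mem_erase.1 hx
        rw [Finset.mem_biUnion]
        rcases Finset.mem_insert.1 hx with rfl | hxU
        · obtain ⟨a', ha', rfl⟩ := Finset.mem_map.1 ha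
          exact ⟨a', ha', by simpa [t] using ⟨hx0, hab⟩⟩
        · obtain ⟨a', ha', rfl⟩ := Finset.mem_map.1 hxU
          exact ⟨a', ha', by simpa [t] using ⟨hx0, hdiag _⟩⟩
      calc s.card = U.card := by simp [hUdef]
        _ = (insert b U).card - 1 := by rw [Finset.card_insert_of_notMem hb]; rfl
        _ ≤ ((insert b U).erase b₀).card := Finset.pred_card_le_card_erase
        _ ≤ _ := Finset.card_le_card hsub)
  have hft' : ∀ a, f a ≠ b₀ ∧ ¬ IsFixedZero Θ (A (r a) (c (f a))) := fun a => by
    simpa [t] using hft a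
  -- Permuting the columns by `g` puts the unknown entry on the diagonal, next to a transversal of
  -- the complementary minor.
  let g : ι → ι := fun a => if h : a = a₀ then b₀ else f ⟨a, h⟩
  have hg0 : g a₀ = b₀ := by simp [g]
  have hg1 : ∀ a : {a // a ≠ a₀}, g a = f a := fun a => by simp [g, a.2]
  have hginj : g.Injective := by
    intro a a' h
    by_cases ha : a = a₀ <;> by_cases ha' : a' = a₀
    · rw [ha, ha']
    · rw [ha, hg0, hg1 ⟨a', ha'⟩] at h
      exact absurd h.symm (hft' _).1
    · rw [ha', hg0, hg1 ⟨a, ha⟩] at h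
      exact absurd h (hft' _).1
    · rw [hg1 ⟨a, ha⟩, hg1 ⟨a', ha'⟩] at h
      exact congrArg Subtype.val (hfinj h)
  let e : Equiv.Perm ι := Equiv.ofBijective g (Finite.injective_iff_bijective.1 hginj)
  have hmain := ae_det_ne_zero_of_unknown_diagonal hS hA hr (hc.comp hginj) a₀
    (by simpa [hg0] using hunk)
    (ih _ (Fintype.card_subtype_lt (x := a₀) (by simp)) {a // a ≠ a₀} (fun a => r a)
      (fun a => c (g a)) rfl (hr.comp Subtype.val_injective)
      ((hc.comp hginj).comp Subtype.val_injective) (fun a => by rw [hg1]; exact (hft' a).2))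
  filter_upwards [hmain] with θ hθ hmem h0
  apply hθ hmem
  have := Matrix.det_permute' e (Matrix.of fun a b => A (r a) (c b) θ)
  rw [h0, mul_zero] at this
  exact this

end Mixed

end DynNet

/-! ### Vertex disjoint paths and transversals -/

namespace DynNet

section Paths

variable {L r : ℕ} {E : Type}

/-- A permutation of the internal vertices that leaves the vertices `b s` through edges starting in
`a s`, and all others through edges or self loops, gives vertex disjoint paths from the `a s` to the
`b s`. -/
theorem exists_disjoint_paths_of_perm (Γ : Digraph (Fin L ⊕ E)) (π : Equiv.Perm (Fin L))
    {b : Fin r → Fin L} (hb : b.Injective) {a : Fin r → E} (ha : a.Injective)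
    (hstart : ∀ s, Γ.Adj (Sum.inr (a s)) (Sum.inl (π (b s))))
    (hstep : ∀ l, l ∉ Set.range b → π l ≠ l → Γ.Adj (Sum.inl l) (Sum.inl (π l))) :
    ∃ P : Fin r → List (Fin L ⊕ E),
      (∀ s, IsPathFromTo Γ (Sum.inr '' Set.range a) (Sum.inl '' Set.range b) (P s)) ∧
      ∀ s s', s ≠ s' → (P s).Disjoint (P s') := by
  classical
  have hex : ∀ s, ∃ t, 0 < t ∧ (π ^ t) (b s) ∈ Set.range b := fun s =>
    ⟨orderOf π, orderOf_pos π, by rw [pow_orderOf_eq_one]; exact ⟨s, rfl⟩⟩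
  -- Time of first return of the orbit of `b s` to the set of ends. Before it the orbit meets no
  -- end, so π is injective along these orbit pieces in a way that keeps pieces for different `s`
  -- disjoint. Path `s` is this piece with its start `b s` replaced by `a s`.
  let N : Fin r → ℕ := fun s => Nat.find (hex s)
  have hNpos : ∀ s, 0 < N s := fun s => (Nat.find_spec (hex s)).1
  have hNmem : ∀ s, (π ^ N s) (b s) ∈ Set.range b := fun s => (Nat.find_spec (hex s)).2
  have hNmin : ∀ s t, 0 < t → t < N s → (π ^ t) (b s) ∉ Set.range b := fun s t h0 ht h =>
    Nat.find_min (hex s) ht ⟨h0, h⟩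
  let q : Fin r → ℕ → Fin L ⊕ E := fun s t =>
    if t = 0 then Sum.inr (a s) else Sum.inl ((π ^ t) (b s))
  have hq0 : ∀ s, q s 0 = Sum.inr (a s) := fun s => by simp [q]
  have hq1 : ∀ s t, q s (t + 1) = Sum.inl ((π ^ (t + 1)) (b s)) := fun s t => by simp [q]
  have haux : ∀ s s' t t', t ≤ t' → t' < N s' → (π ^ (t + 1)) (b s) = (π ^ (t' + 1)) (b s') →
      s = s' ∧ t = t' := by
    intro s s' t t' h ht' heq
    obtain ⟨d, rfl⟩ := Nat.exists_eq_add_of_le h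
    have h1 : (π ^ d) (b s') = b s := by
      apply (π ^ (t + 1)).injective
      rw [heq, ← Equiv.Perm.mul_apply, ← pow_add]
      congr 2
      omega
    rcases Nat.eq_zero_or_pos d with rfl | hd
    · exact ⟨(hb (by simpa using h1)).symm, rfl⟩
    · exact absurd ⟨s, h1.symm⟩ (hNmin s' d hd (by omega))
  have hqinj : ∀ s s' t t', t ≤ N s → t' ≤ N s' → q s t = q s' t' → s = s' ∧ t = t' := by
    intro s s' t t' ht ht' heq
    rcases t with _ | t <;> rcases t' with _ | t'
    · rw [hq0, hq0] at heq
      exact ⟨ha (Sum.inr_injective heq), rfl⟩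
    · rw [hq0, hq1] at heq
      cases heq
    · rw [hq0, hq1] at heq
      cases heq
    · rw [hq1, hq1] at heq
      have heq := Sum.inl_injective heq
      rcases le_total t t' with h | h
      · obtain ⟨h1, h2⟩ := haux s s' t t' h (by omega) heq
        exact ⟨h1, by omega⟩
      · obtain ⟨h1, h2⟩ := haux s' s t' t h (by omega) heq.symm
        exact ⟨h1.symm, by omega⟩
  refine ⟨fun s => (List.range (N s + 1)).map (q s), fun s => ⟨?_, ?_, ?_, ?_⟩, ?_⟩
  · rw [List.isChain_iff_getElem]
    intro t ht
    simp only [List.length_map, List.length_range] at ht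
    simp only [List.getElem_map, List.getElem_range]
    rcases t with _ | t
    · rw [hq0, hq1]
      simpa using hstart s
    · rw [hq1, hq1, pow_succ' π (t + 1), Equiv.Perm.mul_apply]
      -- A self loop is impossible here, since the path would visit the same vertex at two
      -- consecutive times.
      refine hstep _ (hNmin s _ (by omega) (by omega)) fun hfix => ?_
      have : (π ^ (t + 1 + 1)) (b s) = (π ^ (t + 1)) (b s) := by
        rw [pow_succ' π (t + 1), Equiv.Perm.mul_apply, hfix]
      have := (haux s s t (t + 1) (by omega) (by omega) this.symm).2
      omega
  · refine List.Nodup.map_on (fun t ht t' ht' h => ?_) List.nodup_range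
    rw [List.mem_range] at ht ht'
    exact (hqinj s s t t' (by omega) (by omega) h).2
  · exact ⟨_, ⟨_, ⟨s, rfl⟩, rfl⟩, by simp [List.range_succ_eq_map, hq0]⟩
  · refine ⟨_, ⟨_, hNmem s, rfl⟩, ?_⟩
    have : q s (N s) = Sum.inl ((π ^ N s) (b s)) := by
      obtain ⟨t, ht⟩ := Nat.exists_eq_succ_of_ne_zero (hNpos s).ne'
      rw [ht, Nat.succ_eq_add_one, hq1]
    simp [List.range_succ, this]
  · intro s s' hne x hx hx'
    obtain ⟨t, ht, rfl⟩ := List.mem_map.1 hx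
    obtain ⟨t', ht', h⟩ := List.mem_map.1 hx'
    rw [List.mem_range] at ht ht'
    exact hne (hqinj s' s t' t (by omega) (by omega) h).1.symm

/-- Vertex disjoint paths from external to internal vertices give an injective choice, for each
internal vertex, of a predecessor or the vertex itself, which avoids the ends of the paths. -/
theorem exists_predecessor_of_disjoint_paths (Γ : Digraph (Fin L ⊕ E))
    (hΓ : ∀ v x, ¬ Γ.Adj v (Sum.inr x)) {A : Set E} {B : Set (Fin L)}
    {P : Fin r → List (Fin L ⊕ E)}
    (hP : ∀ s, IsPathFromTo Γ (Sum.inr '' A) (Sum.inl '' B) (P s))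
    (hdisj : ∀ s s', s ≠ s' → (P s).Disjoint (P s')) :
    ∃ (e : Fin r → Fin L) (σ : Fin L → Fin L ⊕ E), e.Injective ∧ (∀ s, e s ∈ B) ∧ σ.Injective ∧
      (∀ m, σ m = Sum.inl m ∨ Γ.Adj (σ m) (Sum.inl m)) ∧ (∀ m s, σ m ≠ Sum.inl (e s)) ∧
      ∀ m x, σ m = Sum.inr x → x ∈ A := by
  classical
  have hlast : ∀ s, ∃ k ∈ B, (P s).getLast? = some (Sum.inl k) := by
    intro s
    obtain ⟨_, ⟨k, hk, rfl⟩, h⟩ := (hP s).2.2.2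
    exact ⟨k, hk, h⟩
  choose e heB he using hlast
  have hemem : ∀ s, Sum.inl (e s) ∈ P s := fun s => List.mem_of_getLast? (he s)
  have hsame : ∀ {s s' x}, x ∈ P s → x ∈ P s' → s = s' := by
    intro s s' x hx hx'
    by_contra hne
    exact hdisj s s' hne hx hx'
  have hpred : ∀ m s, Sum.inl m ∈ P s →
      ∃ t, ∃ h : t + 1 < (P s).length, (P s)[t + 1] = Sum.inl m := by
    intro m s hm
    obtain ⟨t, ht, hget⟩ := List.getElem_of_mem hm
    rcases t with _ | t
    · exfalso
      obtain ⟨_, ⟨x, _, rfl⟩, hx⟩ := (hP s).2.2.1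
      rw [List.head?_eq_getElem?, List.getElem?_eq_getElem ht, hget] at hx
      simp at hx
    · exact ⟨t, ht, hget⟩
  have hadj : ∀ s t (h : t + 1 < (P s).length), Γ.Adj (P s)[t] (P s)[t + 1] := fun s =>
    List.isChain_iff_getElem.1 (hP s).1
  -- A vertex on a path is sent to its predecessor, which exists because paths start at external
  -- vertices; any other vertex is sent to itself. The end of a path precedes nothing, so it is
  -- never a value.
  have hchoice : ∀ m, ∃ v, (∃ s t, ∃ h : t + 1 < (P s).length,
      (P s)[t + 1] = Sum.inl m ∧ (P s)[t] = v) ∨ ((∀ s, Sum.inl m ∉ P s) ∧ v = Sum.inl m) := by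
    intro m
    by_cases hm : ∃ s, Sum.inl m ∈ P s
    · obtain ⟨s, hs⟩ := hm
      obtain ⟨t, h, ht⟩ := hpred m s hs
      exact ⟨_, Or.inl ⟨s, t, h, ht, rfl⟩⟩
    · push Not at hm
      exact ⟨_, Or.inr ⟨hm, rfl⟩⟩
  choose σ hσ using hchoice
  refine ⟨e, σ, fun s s' h => hsame (hemem s) (h ▸ hemem s'), heB, ?_, ?_, ?_, ?_⟩
  · intro m m' h
    rcases hσ m with ⟨s, t, ht, hm, hv⟩ | ⟨hm, hv⟩ <;>
      rcases hσ m' with ⟨s', t', ht', hm', hv'⟩ | ⟨hm', hv'⟩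
    · rw [← hv, ← hv'] at h
      have hmem : (P s)[t] ∈ P s' := by
        rw [h]
        exact List.getElem_mem _
      obtain rfl : s = s' := hsame (List.getElem_mem _) hmem
      obtain rfl : t = t' := (List.Nodup.getElem_inj_iff (hP s).2.1).1 h
      exact Sum.inl_injective (hm.symm.trans hm')
    · exact absurd (by rw [← hv', ← h, ← hv]; exact List.getElem_mem _) (hm' s)
    · exact absurd (by rw [← hv, h, ← hv']; exact List.getElem_mem _) (hm s')
    · exact Sum.inl_injective (hv.symm.trans (h.trans hv'))
  · intro m
    rcases hσ m with ⟨s, t, ht, hm, hv⟩ | ⟨hm, hv⟩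
    · right
      rw [← hv, ← hm]
      exact hadj s t ht
    · exact Or.inl hv
  · intro m s' h
    rcases hσ m with ⟨s, t, ht, hm, hv⟩ | ⟨hm, hv⟩
    · rw [← hv] at h
      obtain rfl : s = s' := hsame (List.getElem_mem (by omega)) (h ▸ hemem s')
      have h1 := he s
      rw [List.getLast?_eq_getElem?, List.getElem?_eq_getElem (by omega), ← h,
        Option.some_inj, List.Nodup.getElem_inj_iff (hP s).2.1] at h1
      omega
    · exact hm s' (by rw [← hv, h]; exact hemem s')
  · intro m x h
    rcases hσ m with ⟨s, t, ht, hm, hv⟩ | ⟨hm, hv⟩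
    · rw [h] at hv
      rcases t with _ | t
      · obtain ⟨_, ⟨y, hy, rfl⟩, hx⟩ := (hP s).2.2.1
        rw [List.head?_eq_getElem?, List.getElem?_eq_getElem (by omega), hv] at hx
        simp only [Option.some_inj, Sum.inr.injEq] at hx
        exact hx ▸ hy
      · have := hadj s t (by omega)
        rw [hv] at this
        exact absurd this (hΓ _ _)
    · rw [h] at hv
      cases hv

/-- Disjoint paths have distinct first vertices. Boundedness makes the supremum in
`maxDisjointPaths` a maximum; an unbounded set of naturals would have supremum 0. -/
theorem bddAbove_disjoint_paths {V : Type} [Finite V] (Γ : Digraph V) (A B : Set V) :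
    BddAbove {k : ℕ | ∃ P : Fin k → List V,
      (∀ a, IsPathFromTo Γ A B (P a)) ∧ ∀ a b, a ≠ b → (P a).Disjoint (P b)} := by
  refine ⟨Nat.card V, ?_⟩
  rintro k ⟨P, hP, hdisj⟩
  choose f _ hf using fun s => (hP s).2.2.1
  have hinj : f.Injective := by
    intro s s' h
    by_contra hne
    exact hdisj s s' hne (List.mem_of_mem_head? (hf s)) (h ▸ List.mem_of_mem_head? (hf s'))
  simpa using Nat.card_le_card_of_injective f hinj

theorem exists_maxDisjointPaths {V : Type} [Finite V] (Γ : Digraph V) (A B : Set V) :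
    ∃ P : Fin (maxDisjointPaths Γ A B) → List V,
      (∀ a, IsPathFromTo Γ A B (P a)) ∧ ∀ a b, a ≠ b → (P a).Disjoint (P b) :=
  Nat.sSup_mem (s := {k : ℕ | ∃ P : Fin k → List V,
      (∀ a, IsPathFromTo Γ A B (P a)) ∧ ∀ a b, a ≠ b → (P a).Disjoint (P b)})
    ⟨0, fun k => k.elim0, fun k => k.elim0, fun k => k.elim0⟩ (bddAbove_disjoint_paths Γ A B)

theorem le_maxDisjointPaths {V : Type} [Finite V] (Γ : Digraph V) {A B : Set V} {k : ℕ}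
    {P : Fin k → List V} (hP : ∀ a, IsPathFromTo Γ A B (P a))
    (hdisj : ∀ a b, a ≠ b → (P a).Disjoint (P b)) : k ≤ maxDisjointPaths Γ A B :=
  le_csSup (bddAbove_disjoint_paths Γ A B) ⟨P, hP, hdisj⟩

theorem IsPathFromTo.mono {V : Type} {Γ : Digraph V} {A A' B B' : Set V} {p : List V}
    (h : IsPathFromTo Γ A B p) (hA : A ⊆ A') (hB : B ⊆ B') : IsPathFromTo Γ A' B' p := by
  obtain ⟨h1, h2, ⟨a, ha, ha'⟩, ⟨b, hb, hb'⟩⟩ := h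
  exact ⟨h1, h2, ⟨a, hA ha, ha'⟩, ⟨b, hB hb, hb'⟩⟩

end Paths

end DynNet

/-! ### Ranks of responses and numbers of disjoint paths -/

namespace DynNet

open MeasureTheory

section LinearAlgebra

variable {K : Type*} [Field K]

/-- Keep the off-diagonal pattern and put t on the diagonal: the determinant is a characteristic
polynomial evaluated at t, and all but finitely many t are nonzero and not roots. -/
theorem exists_pattern_det_ne_zero [Infinite K] {ι : Type*} [Fintype ι] [DecidableEq ι]
    (A : Matrix ι ι K) (hA : ∀ a, A a a ≠ 0) :
    ∃ B : Matrix ι ι K, (∀ a b, B a b = 0 ↔ A a b = 0) ∧ B.det ≠ 0 := by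
  classical
  let N : Matrix ι ι K := Matrix.of fun a b => if a = b then 0 else A a b
  obtain ⟨t, ht⟩ := Infinite.exists_notMem_finset (Polynomial.X * N.charpoly).roots.toFinset
  have hne : Polynomial.X * N.charpoly ≠ 0 :=
    mul_ne_zero Polynomial.X_ne_zero N.charpoly_monic.ne_zero
  have ht' : t ≠ 0 ∧ N.charpoly.eval t ≠ 0 := by
    simpa [hne, Polynomial.IsRoot, not_or, N.charpoly_monic.ne_zero] using ht
  refine ⟨Matrix.scalar ι t - N, fun a b => ?_, by rw [← Matrix.eval_charpoly]; exact ht'.2⟩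
  by_cases hab : a = b
  · subst hab
    simp [N, ht'.1, hA]
  · simp [N, hab]

theorem exists_linearIndependent_fin {V : Type*} [AddCommGroup V] [Module K V]
    [Module.Finite K V] (s : Set V) {r : ℕ}
    (hr : Module.finrank K (Submodule.span K s) = r) :
    ∃ f : Fin r → V, (∀ i, f i ∈ s) ∧ LinearIndependent K f := by
  subst hr
  obtain ⟨f, hf, -, hli⟩ := Submodule.exists_fun_fin_finrank_span_eq K s
  exact ⟨f, hf, hli⟩

/-- The rank of a set of rows is realized by a square submatrix. -/
theorem exists_submatrix_det_ne_zero {m n : Type*} [Finite n] (Z : m → n → K)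
    (B : Set m) {r : ℕ} (hr : Module.finrank K (Submodule.span K (Z '' B)) = r) :
    ∃ (b : Fin r → m) (a : Fin r → n), b.Injective ∧ a.Injective ∧ (∀ s, b s ∈ B) ∧
      (Matrix.of fun s s' => Z (b s) (a s')).det ≠ 0 := by
  have := Fintype.ofFinite n
  obtain ⟨f, hf, hli⟩ := exists_linearIndependent_fin (Z '' B) hr
  choose b hbB hb using hf
  have hrank : (Matrix.of f).rank = r := by
    have h : LinearIndependent K (Matrix.of f).row := hli
    simpa using h.rank_matrix
  -- The columns are chosen inside the `r` independent rows already found, whose matrix has column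
  -- rank `r` as well.
  rw [Matrix.rank_eq_finrank_span_cols] at hrank
  obtain ⟨g, hg, hgli⟩ := exists_linearIndependent_fin _ hrank
  choose a ha using hg
  refine ⟨b, a, ?_, ?_, hbB, ?_⟩
  · intro s s' h
    exact hli.injective (by rw [← hb, ← hb, h])
  · intro s s' h
    exact hgli.injective (by rw [← ha, ← ha, h])
  · have : (Matrix.of fun s s' => Z (b s) (a s')).col = g := by
      funext s'
      rw [← ha s']
      funext s
      simp [Matrix.col, ← hb]
    rw [← this, Matrix.linearIndependent_cols_iff_isUnit] at hgli
    exact ((Matrix.isUnit_iff_isUnit_det _).1 hgli).ne_zero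

theorem det_ne_zero_of_card_le_rank {ι : Type*} [Fintype ι] [DecidableEq ι] {A : Matrix ι ι K}
    (h : Fintype.card ι ≤ A.rank) : A.det ≠ 0 := by
  have h1 : LinearIndependent K A.row := by
    rw [linearIndependent_iff_card_le_finrank_span]
    rw [Matrix.rank_eq_finrank_span_row] at h
    exact h
  exact ((Matrix.isUnit_iff_isUnit_det _).1
    (Matrix.linearIndependent_rows_iff_isUnit.1 h1)).ne_zero

end LinearAlgebra

namespace ModelSet

variable {L n : ℕ} (M : ModelSet L n)

theorem card_le_structuralRank {I J ι : Type} [Fintype I] [Fintype J] [Fintype ι] [DecidableEq ι]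
    (A : Matrix I J (RatFunc ℝ)) (eI : ι ≃ I) (eJ : ι ≃ J) (h : ∀ a, A (eI a) (eJ a) ≠ 0) :
    Fintype.card ι ≤ structuralRank A := by
  obtain ⟨B, hB, hdet⟩ := exists_pattern_det_ne_zero (A.submatrix eI eJ) h
  refine le_csSup ⟨Fintype.card J, ?_⟩ ⟨B.submatrix eI.symm eJ.symm, fun a b => ?_, ?_⟩
  · rintro k ⟨B, -, rfl⟩
    exact B.rank_le_card_width
  · simpa using hB (eI.symm a) (eJ.symm b)
  · rw [Matrix.rank_submatrix]
    exact Matrix.rank_of_det_ne_zero hdet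

/-- The diagonal entries, being fixed and not fixed to zero, are nonzero at θ. So the structural
rank is full, and the regularity assumption turns it into the actual rank. -/
theorem fixed_det_ne_zero (hfix : M.HasRegularFixedEntries) {ι : Type} [Fintype ι] [DecidableEq ι]
    {r : ι → Fin L} {c : ι → M.Vertex} (hr : r.Injective) (hc : c.Injective)
    (hfixed : ∀ a b, IsFixed M.Θ fun θ => M.GX θ (r a) (c b))
    (hdiag : ∀ a, ¬ IsFixedZero M.Θ fun θ => M.GX θ (r a) (c a)) {θ : Fin n → ℝ} (hθ : θ ∈ M.Θ) :
    (Matrix.of fun a b => M.GX θ (r a) (c b)).det ≠ 0 := by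
  classical
  let I : Finset (Fin L) := Finset.univ.image r
  let J : Finset M.Vertex := Finset.univ.image c
  let eI : ι ≃ I := Equiv.ofBijective (fun a => ⟨r a, Finset.mem_image_of_mem r (Finset.mem_univ a)⟩)
    ⟨fun a b h => hr (congrArg Subtype.val h), fun x => by
      obtain ⟨a, -, ha⟩ := Finset.mem_image.1 x.2
      exact ⟨a, Subtype.ext ha⟩⟩
  let eJ : ι ≃ J := Equiv.ofBijective (fun a => ⟨c a, Finset.mem_image_of_mem c (Finset.mem_univ a)⟩)
    ⟨fun a b h => hc (congrArg Subtype.val h), fun x => by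
      obtain ⟨a, -, ha⟩ := Finset.mem_image.1 x.2
      exact ⟨a, Subtype.ext ha⟩⟩
  have h1 := hfix I J (by
    intro a ha b hb
    obtain ⟨a, -, rfl⟩ := Finset.mem_image.1 ha
    obtain ⟨b, -, rfl⟩ := Finset.mem_image.1 hb
    exact hfixed a b) θ hθ
  have h2 := card_le_structuralRank
    ((M.GX θ).submatrix (Subtype.val : I → Fin L) (Subtype.val : J → M.Vertex)) eI eJ (by
      intro a h0
      apply hdiag a
      obtain ⟨k, hk⟩ := hfixed a a
      intro θ' hθ'
      have h0' : M.GX θ (r a) (c a) = 0 := h0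
      have h3 := hk θ hθ
      have h4 := hk θ' hθ'
      exact h4.trans (h3.symm.trans h0'))
  rw [← h1, ← Matrix.rank_submatrix _ eI eJ] at h2
  exact det_ne_zero_of_card_le_rank h2

theorem GX_inl {θ : Fin n → ℝ} (k l : Fin L) :
    M.GX θ k (Sum.inl l) = M.G θ k l - (1 : Matrix (Fin L) (Fin L) (RatFunc ℝ)) k l := rfl

theorem GX_inr {θ : Fin n → ℝ} (k : Fin L) (x : M.Ext) : M.GX θ k (Sum.inr x) = M.X θ k x := rfl

theorem X_inl {θ : Fin n → ℝ} (k : Fin L) (x : M.excited) :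
    M.X θ k (Sum.inl x) = if k = x then 1 else 0 := rfl

theorem X_inr_of_mem {θ : Fin n → ℝ} {k : Fin L} (hk : k ∈ M.measured) (x : M.measured) :
    M.X θ k (Sum.inr x) = M.H θ ⟨k, hk⟩ x := by
  change (if h : k ∈ M.measured then M.H θ ⟨k, h⟩ x else 0) = _
  rw [dif_pos hk]

theorem X_inr_of_notMem {θ : Fin n → ℝ} {k : Fin L} (hk : k ∉ M.measured) (x : M.measured) :
    M.X θ k (Sum.inr x) = 0 := by
  change (if h : k ∈ M.measured then M.H θ ⟨k, h⟩ x else 0) = _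
  rw [dif_neg hk]

variable {M}

theorem graph_adj_inl {v : M.Vertex} {k : Fin L} :
    M.graph.Adj v (Sum.inl k) ↔ ¬ IsFixedZero M.Θ (M.entry k v) := by
  constructor
  · rintro ⟨k', hk', h⟩
    obtain rfl := Sum.inl_injective hk'
    exact h
  · exact fun h => ⟨k, rfl, h⟩

theorem graph_not_adj_inr (v : M.Vertex) (x : M.Ext) : ¬ M.graph.Adj v (Sum.inr x) := by
  rintro ⟨k, h, -⟩
  cases h

theorem adj_of_GX_ne_zero {θ : Fin n → ℝ} (hθ : θ ∈ M.Θ) {k : Fin L} {v : M.Vertex}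
    (hv : v ≠ Sum.inl k) (h : M.GX θ k v ≠ 0) : M.graph.Adj v (Sum.inl k) := by
  rw [graph_adj_inl]
  intro h0
  apply h
  have h1 := h0 θ hθ
  rcases v with l | x
  · have : k ≠ l := fun h => hv (h ▸ rfl)
    rw [GX_inl, Matrix.one_apply_ne this, sub_zero]
    exact h1
  · exact h1

/-- A vertex off all paths uses the diagonal entry of G - I, which is -1 because G is hollow. For
empty Θ every entry would count as fixed to zero. -/
theorem not_isFixedZero_GX (hM : M.IsWellPosed) (hne : M.Θ.Nonempty) {k : Fin L} {v : M.Vertex}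
    (h : v = Sum.inl k ∨ M.graph.Adj v (Sum.inl k)) :
    ¬ IsFixedZero M.Θ fun θ => M.GX θ k v := by
  intro h0
  by_cases hv : v = Sum.inl k
  · obtain ⟨θ, hθ⟩ := hne
    have := h0 θ hθ
    subst hv
    simp only [GX_inl, hM.G_hollow θ hθ, Matrix.one_apply_eq] at this
    norm_num at this
  · rw [or_iff_right hv, graph_adj_inl] at h
    apply h
    intro θ hθ
    have h1 := h0 θ hθ
    rcases v with l | x
    · have : k ≠ l := fun h => hv (h ▸ rfl)
      simp only [GX_inl, Matrix.one_apply_ne this, sub_zero] at h1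
      exact h1
    · exact h1

/-- The parameters that enter the entries of `[G - I  X]`. -/
def entryParams (M : ModelSet L n)
    (S : (Fin L × Fin L) ⊕ (M.measured × M.measured) → Set (Fin n)) (k : Fin L) :
    M.Vertex → Set (Fin n)
  | Sum.inl l => S (Sum.inl (k, l))
  | Sum.inr (Sum.inl _) => ∅
  | Sum.inr (Sum.inr x) => if h : k ∈ M.measured then S (Sum.inr (⟨k, h⟩, x)) else ∅

theorem disjoint_entryParams {S : (Fin L × Fin L) ⊕ (M.measured × M.measured) → Set (Fin n)}
    (hS : ∀ e e', e ≠ e' → Disjoint (S e) (S e')) (k : Fin L) (v : M.Vertex) (k' : Fin L)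
    (v' : M.Vertex) (h : (k, v) ≠ (k', v')) :
    Disjoint (M.entryParams S k v) (M.entryParams S k' v') := by
  rcases v with l | x | x <;> rcases v' with l' | x' | x' <;> simp only [entryParams] <;>
    try split_ifs
  all_goals first
    | exact Set.disjoint_empty _
    | exact Set.empty_disjoint _
    | refine hS _ _ fun heq => h ?_
      cases heq <;> rfl

theorem isRationalIn_GX {S : (Fin L × Fin L) ⊕ (M.measured × M.measured) → Set (Fin n)}
    (hG : ∀ a b, IsRationalIn M.Θ (S (Sum.inl (a, b))) fun θ => M.G θ a b)
    (hH : ∀ a b, IsRationalIn M.Θ (S (Sum.inr (a, b))) fun θ => M.H θ a b) (k : Fin L)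
    (v : M.Vertex) : IsRationalIn M.Θ (M.entryParams S k v) fun θ => M.GX θ k v := by
  rcases v with l | x | x
  · simp only [GX_inl, sub_eq_add_neg]
    exact (hG k l).add (isRationalIn_const _)
  · simp only [GX_inr, X_inl]
    exact isRationalIn_const _
  · by_cases hk : k ∈ M.measured
    · simp only [GX_inr, M.X_inr_of_mem hk, entryParams, dif_pos hk]
      exact hH _ _
    · simp only [GX_inr, M.X_inr_of_notMem hk]
      exact isRationalIn_const _

/-- Carries minors of the dense matrix T X over to [G - I X], whose pattern is that of the graph
with self loops added at the internal vertices. -/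
theorem GX_eq_mul {θ : Fin n → ℝ} (hdet : IsUnit (1 - M.G θ).det) :
    M.GX θ = (1 - M.G θ) * Matrix.fromCols (-1) (M.T θ * M.X θ) := by
  rw [Matrix.mul_fromCols, T, ← Matrix.mul_assoc, Matrix.mul_nonsing_inv _ hdet, Matrix.one_mul,
    Matrix.mul_neg, Matrix.mul_one, neg_sub, GX]

theorem det_GX_ne_zero_iff {θ : Fin n → ℝ} (hdet : IsUnit (1 - M.G θ).det)
    (σ : Fin L → M.Vertex) : ((M.GX θ).submatrix id σ).det ≠ 0 ↔
      ((Matrix.fromCols (-1) (M.T θ * M.X θ)).submatrix id σ).det ≠ 0 := by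
  have : (M.GX θ).submatrix id σ =
      (1 - M.G θ) * (Matrix.fromCols (-1) (M.T θ * M.X θ)).submatrix id σ := by
    rw [GX_eq_mul hdet]
    rfl
  rw [this, Matrix.det_mul, mul_ne_zero_iff, and_iff_right hdet.ne_zero]

variable (M)

/-- The response of the signal `w k` to the external signals in `A`. -/
def response (θ : Fin n → ℝ) (A : Set M.Ext) (k : Fin L) (x : A) : RatFunc ℝ :=
  (M.T θ * M.X θ) k x

/-- The dimension of the span of the responses of the signals in `B` to those in `A`. -/
def responseRank (θ : Fin n → ℝ) (A : Set M.Ext) (B : Set (Fin L)) : ℕ :=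
  Module.finrank (RatFunc ℝ) (Submodule.span (RatFunc ℝ) (M.response θ A '' B))

variable {M}

/-- The bound holds at every member of the set, not only at generic ones; it is needed at the
arbitrary competitor θ₁. -/
theorem responseRank_le {θ : Fin n → ℝ} (hθ : θ ∈ M.Θ) (hdet : IsUnit (1 - M.G θ).det)
    (A : Set M.Ext) (B : Set (Fin L)) : M.responseRank θ A B ≤ M.b A B := by
  classical
  obtain ⟨b, a, hb, ha, hbB, hne⟩ :=
    exists_submatrix_det_ne_zero (M.response θ A) B (rfl : _ = M.responseRank θ A B)
  generalize M.responseRank θ A B = r at b a hb ha hbB hne ⊢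
  let eb : Fin r ≃ {l // l ∈ Set.range b} := Equiv.ofInjective b hb
  -- In -I, the columns `b s` are replaced by the columns `a s` of T X. By block triangularity the
  -- determinant becomes the chosen minor up to sign.
  let τ : Fin L → M.Vertex := fun l =>
    if h : l ∈ Set.range b then Sum.inr (a (eb.symm ⟨l, h⟩) : M.Ext) else Sum.inl l
  have hτ1 : ∀ s, τ (b s) = Sum.inr (a s : M.Ext) := by
    intro s
    have h : b s ∈ Set.range b := ⟨s, rfl⟩
    simp only [τ, dif_pos h]
    congr 2
    congr 1
    rw [Equiv.symm_apply_eq]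
    rfl
  have hτ0 : ∀ l, l ∉ Set.range b → τ l = Sum.inl l := fun l h => by simp only [τ, dif_neg h]
  have hW : ((Matrix.fromCols (-1) (M.T θ * M.X θ)).submatrix id τ).det ≠ 0 := by
    rw [Matrix.twoBlockTriangular_det' _ (fun l => l ∈ Set.range b)]
    · refine mul_ne_zero ?_ ?_
      · intro h
        have h0 := Matrix.det_submatrix_equiv_self eb
          (((Matrix.fromCols (-1) (M.T θ * M.X θ)).submatrix id τ).toSquareBlockProp
            fun l => l ∈ Set.range b)
        have h1 : (Matrix.of fun s s' => M.response θ A (b s) (a s')) =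
            (((Matrix.fromCols (-1) (M.T θ * M.X θ)).submatrix id τ).toSquareBlockProp
              fun l => l ∈ Set.range b).submatrix eb eb := by
          ext s s'
          change _ = Matrix.fromCols (-1) (M.T θ * M.X θ) (b s) (τ (b s'))
          rw [hτ1]
          rfl
        rw [h1, h0] at hne
        apply hne
        convert h
      · have : (((Matrix.fromCols (-1) (M.T θ * M.X θ)).submatrix id τ).toSquareBlockProp
            fun l => ¬ l ∈ Set.range b) = -1 := by
          ext k l
          change Matrix.fromCols (-1) (M.T θ * M.X θ) k (τ l) = _
          rw [hτ0 l l.2]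
          simp [Matrix.one_apply, Subtype.ext_iff]
        rw [this, Matrix.det_neg, Matrix.det_one, mul_one]
        exact pow_ne_zero _ (by norm_num)
    · intro k hk l hl
      have hkl : k ≠ l := fun h => hl (h ▸ hk)
      change Matrix.fromCols (-1) (M.T θ * M.X θ) k (τ l) = _
      rw [hτ0 l hl]
      simp [hkl]
  -- A nonzero Leibniz term is a permutation along nonzero entries of [G - I X], that is, along
  -- edges and self loops.
  rw [← det_GX_ne_zero_iff hdet, Matrix.det_apply'] at hW
  obtain ⟨π, -, hπ⟩ := Finset.exists_ne_zero_of_sum_ne_zero hW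
  have hπ' : ∀ l, M.GX θ (π l) (τ l) ≠ 0 := fun l =>
    Finset.prod_ne_zero_iff.1 (right_ne_zero_of_mul hπ) l (Finset.mem_univ l)
  obtain ⟨P, hP, hdisj⟩ := exists_disjoint_paths_of_perm M.graph π hb
    (Subtype.val_injective.comp ha)
    (fun s => adj_of_GX_ne_zero hθ (fun h => by cases h) (by
      change M.GX θ (π (b s)) (Sum.inr (a s : M.Ext)) ≠ 0
      rw [← hτ1]
      exact hπ' _))
    (fun l hl hne => adj_of_GX_ne_zero hθ (fun h => hne (Sum.inl_injective h).symm)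
      (by rw [← hτ0 l hl]; exact hπ' _))
  refine le_maxDisjointPaths M.graph (fun s => (hP s).mono ?_ ?_) hdisj
  · refine Set.image_mono ?_
    rintro _ ⟨s, rfl⟩
    exact (a s).2
  · refine Set.image_mono ?_
    rintro _ ⟨s, rfl⟩
    exact hbB s

/-- A maximal system of paths gives a transversal σ of [G - I X], so the columns σ of [-I T X] are
generically independent, and so are its rows restricted to them. The rows at the path ends only see
responses there. -/
theorem ae_le_responseRank (hM : M.IsWellPosed) (hind : M.IsIndependentlyParameterized)
    (hfix : M.HasRegularFixedEntries) (hdet : ∀ θ ∈ M.Θ, IsUnit (1 - M.G θ).det)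
    (A : Set M.Ext) (B : Set (Fin L)) : ∀ᵐ θ, θ ∈ M.Θ → M.b A B ≤ M.responseRank θ A B := by
  classical
  rcases M.Θ.eq_empty_or_nonempty with hempty | hne
  · exact Filter.Eventually.of_forall fun θ hθ => by simp [hempty] at hθ
  obtain ⟨S, hS, hG, hH⟩ := hind
  obtain ⟨P, hP, hdisj⟩ :=
    exists_maxDisjointPaths M.graph (Sum.inr '' A) (Sum.inl '' B : Set M.Vertex)
  obtain ⟨e, σ, he, heB, hσ, hadj, hσe, hσA⟩ :=
    exists_predecessor_of_disjoint_paths M.graph graph_not_adj_inr hP hdisj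
  have hae := ae_det_ne_zero_of_transversal (A := fun k v θ => M.GX θ k v)
    (disjoint_entryParams hS) (isRationalIn_GX hG hH)
    (fun ι _ _ r c hr hc h1 h2 θ hθ => M.fixed_det_ne_zero hfix hr hc h1 h2 hθ)
    (r := id) (c := σ) Function.injective_id hσ (fun m => not_isFixedZero_GX hM hne (hadj m))
  filter_upwards [hae] with θ hθ hmem
  have h1 := (det_GX_ne_zero_iff (hdet θ hmem) σ).1 (hθ hmem)
  have h2 := Matrix.linearIndependent_rows_iff_isUnit.2
    ((Matrix.isUnit_iff_isUnit_det _).2 (isUnit_iff_ne_zero.2 h1))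
  -- Sends the response of an end `e s` to row `e s` of [-I T X] in the columns σ. The zeros at
  -- internal columns are correct because σ never selects an end.
  let φ : (A → RatFunc ℝ) →ₗ[RatFunc ℝ] (Fin L → RatFunc ℝ) := LinearMap.pi fun l =>
    Sum.elim (fun _ => (0 : (A → RatFunc ℝ) →ₗ[RatFunc ℝ] RatFunc ℝ)) (fun x => if h : x ∈ A then LinearMap.proj ⟨x, h⟩ else 0) (σ l)
  have hφ : (fun s => ((Matrix.fromCols (-1) (M.T θ * M.X θ)).submatrix id σ).row (e s)) =
      φ ∘ fun s => M.response θ A (e s) := by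
    funext s l
    change Matrix.fromCols (-1) (M.T θ * M.X θ) (e s) (σ l) = Sum.elim
      (fun _ => (0 : (A → RatFunc ℝ) →ₗ[RatFunc ℝ] RatFunc ℝ))
      (fun x => if h : x ∈ A then LinearMap.proj ⟨x, h⟩ else 0) (σ l) (M.response θ A (e s))
    rcases hl : σ l with k | x
    · have : e s ≠ k := fun h => hσe l s (by rw [hl, h])
      simp [this]
    · simp only [Sum.elim_inr, dif_pos (hσA l x hl)]
      rfl
  have h3 := h2.comp e he
  change LinearIndependent _ (fun s => Matrix.row _ (e s)) at h3
  rw [hφ] at h3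
  have h4 := h3.of_comp
  have h5 := finrank_span_eq_card h4
  rw [Fintype.card_fin] at h5
  change maxDisjointPaths _ _ _ ≤ _
  rw [← h5]
  refine Submodule.finrank_mono (Submodule.span_mono ?_)
  rintro _ ⟨s, rfl⟩
  exact ⟨e s, heB s, rfl⟩

end ModelSet

end DynNet

/-! ### Limits at infinity of rational matrices -/

namespace DynNet

open MeasureTheory Polynomial

section Infinity

/-- The rational function `f` is proper with limit `c` at infinity. -/
def HasLim (f : RatFunc ℝ) (c : ℝ) : Prop :=
  ∃ a b : ℝ[X], b.Monic ∧ a.natDegree ≤ b.natDegree ∧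
    f = algebraMap ℝ[X] (RatFunc ℝ) a / algebraMap ℝ[X] (RatFunc ℝ) b ∧ a.coeff b.natDegree = c

variable {f g : RatFunc ℝ} {c d : ℝ}

theorem IsProper.hasLim (h : IsProper f) : HasLim f (atInfty f) :=
  ⟨f.num, f.denom, f.monic_denom, h, (RatFunc.num_div_denom f).symm, rfl⟩

theorem hasLim_C (c : ℝ) : HasLim (RatFunc.C c) c :=
  ⟨C c, 1, monic_one, by simp, by simp, by simp⟩

theorem hasLim_zero : HasLim 0 0 := by simpa using hasLim_C 0

theorem hasLim_one : HasLim 1 1 := by simpa using hasLim_C 1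

theorem HasLim.mul (hf : HasLim f c) (hg : HasLim g d) : HasLim (f * g) (c * d) := by
  obtain ⟨a, b, hb, hab, rfl, rfl⟩ := hf
  obtain ⟨a', b', hb', hab', rfl, rfl⟩ := hg
  refine ⟨a * a', b * b', hb.mul hb', ?_, ?_, ?_⟩
  · rw [hb.natDegree_mul hb']
    exact natDegree_mul_le.trans (add_le_add hab hab')
  · rw [map_mul, map_mul, div_mul_div_comm]
  · rw [hb.natDegree_mul hb', coeff_mul_add_eq_of_natDegree_le hab hab']

theorem HasLim.add (hf : HasLim f c) (hg : HasLim g d) : HasLim (f + g) (c + d) := by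
  obtain ⟨a, b, hb, hab, rfl, rfl⟩ := hf
  obtain ⟨a', b', hb', hab', rfl, rfl⟩ := hg
  refine ⟨a * b' + b * a', b * b', hb.mul hb', ?_, ?_, ?_⟩
  · rw [hb.natDegree_mul hb']
    exact natDegree_add_le_of_degree_le (natDegree_mul_le.trans (add_le_add_left hab _))
      (natDegree_mul_le.trans (add_le_add_right hab' _))
  · rw [map_add, map_mul, map_mul, map_mul, div_add_div]
    · simpa using hb.ne_zero
    · simpa using hb'.ne_zero
  · rw [hb.natDegree_mul hb', coeff_add, coeff_mul_add_eq_of_natDegree_le hab le_rfl,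
      coeff_mul_add_eq_of_natDegree_le le_rfl hab', hb.coeff_natDegree, hb'.coeff_natDegree, mul_one,
      one_mul]

theorem HasLim.neg (hf : HasLim f c) : HasLim (-f) (-c) := by
  simpa using (hasLim_C (-1)).mul hf

theorem HasLim.sum {ι : Type*} (s : Finset ι) {F : ι → RatFunc ℝ} {e : ι → ℝ}
    (h : ∀ a ∈ s, HasLim (F a) (e a)) : HasLim (∑ a ∈ s, F a) (∑ a ∈ s, e a) := by
  classical
  induction s using Finset.induction_on with
  | empty => simpa using hasLim_zero
  | insert a s ha ih =>
    rw [Finset.sum_insert ha, Finset.sum_insert ha]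
    exact (h a (Finset.mem_insert_self _ _)).add
      (ih fun b hb => h b (Finset.mem_insert_of_mem hb))

theorem HasLim.prod {ι : Type*} (s : Finset ι) {F : ι → RatFunc ℝ} {e : ι → ℝ}
    (h : ∀ a ∈ s, HasLim (F a) (e a)) : HasLim (∏ a ∈ s, F a) (∏ a ∈ s, e a) := by
  classical
  induction s using Finset.induction_on with
  | empty => simpa using hasLim_one
  | insert a s ha ih =>
    rw [Finset.prod_insert ha, Finset.prod_insert ha]
    exact (h a (Finset.mem_insert_self _ _)).mul
      (ih fun b hb => h b (Finset.mem_insert_of_mem hb))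

theorem HasLim.unique (hf : HasLim f c) (hf' : HasLim f d) : c = d := by
  obtain ⟨a, b, hb, hab, rfl, rfl⟩ := hf
  obtain ⟨a', b', hb', hab', h, rfl⟩ := hf'
  rw [div_eq_div_iff (by simpa using hb.ne_zero) (by simpa using hb'.ne_zero), ← map_mul,
    ← map_mul] at h
  have h := congrArg (fun p => p.coeff (b.natDegree + b'.natDegree))
    (RatFunc.algebraMap_injective ℝ h)
  rw [coeff_mul_add_eq_of_natDegree_le hab le_rfl, add_comm, coeff_mul_add_eq_of_natDegree_le hab' le_rfl,
    hb.coeff_natDegree, hb'.coeff_natDegree, mul_one, mul_one] at h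
  exact h

theorem HasLim.ne_zero (hf : HasLim f c) (hc : c ≠ 0) : f ≠ 0 := by
  rintro rfl
  exact hc (hf.unique hasLim_zero)

theorem HasLim.inv (hf : HasLim f c) (hc : c ≠ 0) : HasLim f⁻¹ c⁻¹ := by
  obtain ⟨a, b, hb, hab, rfl, rfl⟩ := hf
  have hdeg : a.natDegree = b.natDegree := le_antisymm hab (le_natDegree_of_ne_zero hc)
  have hlc : a.leadingCoeff = a.coeff b.natDegree := by rw [leadingCoeff, hdeg]
  have hC : algebraMap ℝ[X] (RatFunc ℝ) (C (a.coeff b.natDegree)⁻¹) ≠ 0 := by simpa using hc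
  have hdeg' : (a * C (a.coeff b.natDegree)⁻¹).natDegree = b.natDegree := by
    rw [natDegree_mul_C (inv_ne_zero hc), hdeg]
  refine ⟨b * C (a.coeff b.natDegree)⁻¹, a * C (a.coeff b.natDegree)⁻¹, ?_, ?_, ?_, ?_⟩
  · rw [← hlc]
    exact monic_mul_leadingCoeff_inv (fun h => hc (by simp [h]))
  · rw [hdeg', natDegree_mul_C (inv_ne_zero hc)]
  · rw [map_mul, map_mul, inv_div, mul_div_mul_right _ _ hC]
  · rw [hdeg', coeff_mul_C, hb.coeff_natDegree, one_mul]

theorem HasLim.isProper (hf : HasLim f c) : IsProper f := by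
  obtain ⟨a, b, hb, hab, h, -⟩ := hf
  rw [IsProper]
  by_cases h0 : f.num = 0
  · simp [h0]
  have h1 : f.num * b = a * f.denom := by
    apply RatFunc.algebraMap_injective ℝ
    rw [map_mul, map_mul, ← div_eq_div_iff (by simpa using f.denom_ne_zero)
      (by simpa using hb.ne_zero), RatFunc.num_div_denom]
    exact h
  have ha : a ≠ 0 := by
    rintro rfl
    rw [zero_mul] at h1
    exact (mul_ne_zero h0 hb.ne_zero) h1
  have h2 := congrArg natDegree h1
  rw [natDegree_mul h0 hb.ne_zero, natDegree_mul ha f.denom_ne_zero] at h2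
  omega

variable {ι κ μ : Type*}

/-- Entrywise limits at infinity. -/
def HasLimM (A : Matrix μ ι (RatFunc ℝ)) (B : Matrix μ ι ℝ) : Prop :=
  ∀ a b, HasLim (A a b) (B a b)

theorem HasLimM.mul [Fintype ι] {A : Matrix μ ι (RatFunc ℝ)} {A' : Matrix ι κ (RatFunc ℝ)}
    {B : Matrix μ ι ℝ} {B' : Matrix ι κ ℝ} (h : HasLimM A B) (h' : HasLimM A' B') :
    HasLimM (A * A') (B * B') := fun a b => by
  rw [Matrix.mul_apply, Matrix.mul_apply]
  exact HasLim.sum _ fun k _ => (h a k).mul (h' k b)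

theorem hasLimM_map_C (A : Matrix μ ι ℝ) : HasLimM (A.map RatFunc.C) A := fun _ _ => hasLim_C _

theorem HasLimM.unique {A : Matrix μ ι (RatFunc ℝ)} {B B' : Matrix μ ι ℝ} (h : HasLimM A B)
    (h' : HasLimM A B') : B = B' := by
  ext a b
  exact (h a b).unique (h' a b)

theorem hasLimM_one [DecidableEq ι] : HasLimM (1 : Matrix ι ι (RatFunc ℝ)) 1 := fun a b => by
  rw [Matrix.one_apply, Matrix.one_apply]
  split_ifs
  · exact hasLim_one
  · exact hasLim_zero

variable [Fintype ι] [DecidableEq ι] {A : Matrix ι ι (RatFunc ℝ)} {B : Matrix ι ι ℝ}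

theorem HasLimM.det (h : HasLimM A B) : HasLim A.det B.det := by
  rw [Matrix.det_apply', Matrix.det_apply']
  refine HasLim.sum _ fun σ _ => HasLim.mul ?_ (HasLim.prod _ fun a _ => h _ _)
  have := hasLim_C ((Equiv.Perm.sign σ : ℤ) : ℝ)
  rwa [map_intCast] at this

theorem HasLimM.inv (h : HasLimM A B) (hB : B.det ≠ 0) : HasLimM A⁻¹ B⁻¹ := fun a b => by
  rw [Matrix.inv_def, Matrix.inv_def, Ring.inverse_eq_inv', Ring.inverse_eq_inv',
    Matrix.smul_apply, Matrix.smul_apply, smul_eq_mul, smul_eq_mul, Matrix.adjugate_apply,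
    Matrix.adjugate_apply]
  refine (h.det.inv hB).mul (HasLimM.det fun k l => ?_)
  by_cases hk : k = b
  · subst hk
    rw [Matrix.updateRow_self, Matrix.updateRow_self, Pi.single_apply, Pi.single_apply]
    split_ifs
    · exact hasLim_one
    · exact hasLim_zero
  · rw [Matrix.updateRow_ne hk, Matrix.updateRow_ne hk]
    exact h k l

/-- Principal minors of the inverse are complementary principal minors. -/
theorem det_mul_det_inv_submatrix {K : Type*} [Field K] (N : Matrix ι ι K) (hN : N.det ≠ 0)
    (p : ι → Prop) [DecidablePred p] :
    N.det * (N⁻¹.submatrix (Subtype.val : {a // p a} → ι) Subtype.val).det =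
      (N.submatrix (Subtype.val : {a // ¬ p a} → ι) Subtype.val).det := by
  -- Columns of the inverse on `p`, of the identity elsewhere. Then `N * W` has columns of the
  -- identity on `p` and of `N` elsewhere; compare determinants.
  let W : Matrix ι ι K := Matrix.of fun k l => if p l then N⁻¹ k l else (1 : Matrix ι ι K) k l
  have h1 : W.det = (N⁻¹.submatrix (Subtype.val : {a // p a} → ι) Subtype.val).det := by
    rw [Matrix.twoBlockTriangular_det' W p]
    · have e1 : W.toSquareBlockProp p = N⁻¹.submatrix Subtype.val Subtype.val := by
        ext k l
        simp [W, Matrix.toSquareBlockProp_def, l.2]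
      have e2 : W.toSquareBlockProp (fun a => ¬ p a) = 1 := by
        ext k l
        simp [W, Matrix.toSquareBlockProp_def, l.2, Matrix.one_apply, Subtype.ext_iff]
      rw [e1, e2, Matrix.det_one, mul_one]
    · intro k hk l hl
      have : k ≠ l := fun h => hl (h ▸ hk)
      simp [W, hl, this]
  have h2 : (N * W).det = (N.submatrix (Subtype.val : {a // ¬ p a} → ι) Subtype.val).det := by
    have hmul : N * W = Matrix.of fun k l => if p l then (1 : Matrix ι ι K) k l else N k l := by
      ext k l
      by_cases hl : p l
      · have : (N * W) k l = (N * N⁻¹) k l := by simp [Matrix.mul_apply, W, hl]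
        rw [this, Matrix.mul_nonsing_inv _ (isUnit_iff_ne_zero.2 hN)]
        simp [hl]
      · have : (N * W) k l = (N * (1 : Matrix ι ι K)) k l := by simp [Matrix.mul_apply, W, hl]
        rw [this, Matrix.mul_one]
        simp [hl]
    rw [hmul, Matrix.twoBlockTriangular_det _ p]
    · have e1 : (Matrix.of fun k l => if p l then (1 : Matrix ι ι K) k l else N k l).toSquareBlockProp
          p = 1 := by
        ext k l
        simp [Matrix.toSquareBlockProp_def, l.2, Matrix.one_apply, Subtype.ext_iff]
      have e2 : (Matrix.of fun k l => if p l then (1 : Matrix ι ι K) k l else N k l).toSquareBlockProp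
          (fun a => ¬ p a) = N.submatrix Subtype.val Subtype.val := by
        ext k l
        simp [Matrix.toSquareBlockProp_def, l.2]
      rw [e1, e2, Matrix.det_one, one_mul]
    · intro k hk l hl
      have : k ≠ l := fun h => hk (h ▸ hl)
      simp [hl, this]
  rw [← h1, ← h2, Matrix.det_mul]

end Infinity

/-! ### Evaluation on the unit circle -/

section Evaluation

/-- `z` is not a pole of `f`. -/
def IsRegularAt (z : ℂ) (f : RatFunc ℝ) : Prop := aeval z f.denom ≠ 0

variable {z : ℂ} {f g : RatFunc ℝ}

theorem evalAt_eq (z : ℂ) (f : RatFunc ℝ) : evalAt z f = aeval z f.num / aeval z f.denom := rfl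

theorem isRegularAt_C (z : ℂ) (c : ℝ) : IsRegularAt z (RatFunc.C c) := by
  simp [IsRegularAt]

theorem evalAt_C (z : ℂ) (c : ℝ) : evalAt z (RatFunc.C c) = c := by
  simp [evalAt]

theorem IsRegularAt.add (hf : IsRegularAt z f) (hg : IsRegularAt z g) : IsRegularAt z (f + g) := by
  intro h
  have := map_dvd (aeval z) (RatFunc.denom_add_dvd f g)
  rw [h, zero_dvd_iff, map_mul] at this
  exact mul_ne_zero hf hg this

theorem IsRegularAt.mul (hf : IsRegularAt z f) (hg : IsRegularAt z g) : IsRegularAt z (f * g) := by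
  intro h
  have := map_dvd (aeval z) (RatFunc.denom_mul_dvd f g)
  rw [h, zero_dvd_iff, map_mul] at this
  exact mul_ne_zero hf hg this

theorem evalAt_add (hf : IsRegularAt z f) (hg : IsRegularAt z g) :
    evalAt z (f + g) = evalAt z f + evalAt z g := RatFunc.eval_add _ _ hf hg

theorem evalAt_mul (hf : IsRegularAt z f) (hg : IsRegularAt z g) :
    evalAt z (f * g) = evalAt z f * evalAt z g := RatFunc.eval_mul _ _ hf hg

theorem isRegularAt_sum {ι : Type*} (s : Finset ι) {F : ι → RatFunc ℝ}
    (h : ∀ a ∈ s, IsRegularAt z (F a)) :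
    IsRegularAt z (∑ a ∈ s, F a) ∧ evalAt z (∑ a ∈ s, F a) = ∑ a ∈ s, evalAt z (F a) := by
  classical
  induction s using Finset.induction_on with
  | empty =>
    have h1 := isRegularAt_C z 0
    have h2 := evalAt_C z 0
    rw [map_zero] at h1 h2
    simpa using ⟨h1, h2⟩
  | insert a s ha ih =>
    rw [Finset.sum_insert ha, Finset.sum_insert ha]
    have h1 := h a (Finset.mem_insert_self _ _)
    obtain ⟨h2, h3⟩ := ih fun b hb => h b (Finset.mem_insert_of_mem hb)
    exact ⟨h1.add h2, by rw [evalAt_add h1 h2, h3]⟩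

variable {ι κ μ : Type*}

/-- `z` is not a pole of any entry of `A`. -/
def IsRegularM (z : ℂ) (A : Matrix μ ι (RatFunc ℝ)) : Prop := ∀ a b, IsRegularAt z (A a b)

theorem IsRegularM.mul [Fintype ι] {A : Matrix μ ι (RatFunc ℝ)} {B : Matrix ι κ (RatFunc ℝ)}
    (hA : IsRegularM z A) (hB : IsRegularM z B) : IsRegularM z (A * B) := fun a b => by
  rw [Matrix.mul_apply]
  exact (isRegularAt_sum _ fun k _ => (hA a k).mul (hB k b)).1

theorem map_evalAt_mul [Fintype ι] {A : Matrix μ ι (RatFunc ℝ)} {B : Matrix ι κ (RatFunc ℝ)}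
    (hA : IsRegularM z A) (hB : IsRegularM z B) :
    (A * B).map (evalAt z) = A.map (evalAt z) * B.map (evalAt z) := by
  ext a b
  rw [Matrix.map_apply, Matrix.mul_apply, Matrix.mul_apply,
    (isRegularAt_sum _ fun k _ => (hA a k).mul (hB k b)).2]
  exact Finset.sum_congr rfl fun k _ => evalAt_mul (hA a k) (hB k b)

theorem isRegularM_map_C (z : ℂ) (A : Matrix μ ι ℝ) : IsRegularM z (A.map RatFunc.C) :=
  fun _ _ => isRegularAt_C _ _

theorem map_evalAt_map_C (z : ℂ) (A : Matrix μ ι ℝ) :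
    (A.map RatFunc.C).map (evalAt z) = A.map (algebraMap ℝ ℂ) := by
  ext a b
  exact evalAt_C _ _

theorem map_evalAt_one (z : ℂ) [DecidableEq ι] :
    (1 : Matrix ι ι (RatFunc ℝ)).map (evalAt z) = 1 :=
  Matrix.map_one _ (by simp [evalAt]) (by simp [evalAt])

/-- The point of the unit circle at frequency `ω`. -/
def circlePt (ω : ℝ) : ℂ := Complex.exp (Complex.I * ω)

theorem norm_circlePt (ω : ℝ) : ‖circlePt ω‖ = 1 := by
  rw [circlePt, mul_comm]
  exact Complex.norm_exp_ofReal_mul_I ω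

theorem continuous_circlePt : Continuous circlePt := by
  unfold circlePt
  fun_prop

theorem exists_circlePt (hz : ‖z‖ = 1) : ∃ ω, circlePt ω = z := by
  refine ⟨z.arg, ?_⟩
  have := Complex.norm_mul_exp_arg_mul_I z
  rw [hz, Complex.ofReal_one, one_mul, mul_comm] at this
  exact this

theorem ae_aeval_circlePt_ne_zero {q : ℝ[X]} (hq : q ≠ 0) :
    ∀ᵐ ω : ℝ, aeval (circlePt ω) q ≠ 0 := by
  rw [ae_iff]
  refine Set.Countable.measure_zero ?_ _
  have hfin : {w : ℂ | aeval w q = 0}.Finite := by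
    have := (q.aroots ℂ).toFinset.finite_toSet
    refine this.subset fun w hw => ?_
    simpa [hq] using hw
  have hpre : {ω : ℝ | ¬ aeval (circlePt ω) q ≠ 0} = ⋃ w ∈ {w : ℂ | aeval w q = 0},
      {ω : ℝ | circlePt ω = w} := by
    ext ω
    simp
  rw [hpre]
  refine hfin.countable.biUnion fun w _ => ?_
  by_cases hw : ∃ ω₀, circlePt ω₀ = w
  · obtain ⟨ω₀, rfl⟩ := hw
    refine (Set.countable_range fun m : ℤ => ω₀ + m * (2 * Real.pi)).mono fun ω hω => ?_
    obtain ⟨m, hm⟩ := Complex.exp_eq_exp_iff_exists_int.1 hω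
    refine ⟨m, ?_⟩
    have h2 : (ω : ℂ) = ω₀ + m * (2 * Real.pi) := by
      have hI := Complex.I_ne_zero
      apply mul_left_cancel₀ hI
      rw [hm]
      ring
    exact_mod_cast h2.symm
  · push Not at hw
    convert Set.countable_empty
    ext ω
    simpa using hw ω

theorem ae_isRegularAt (f : RatFunc ℝ) : ∀ᵐ ω : ℝ, IsRegularAt (circlePt ω) f :=
  ae_aeval_circlePt_ne_zero f.denom_ne_zero

theorem ae_isRegularM [Finite μ] [Finite ι] (A : Matrix μ ι (RatFunc ℝ)) :
    ∀ᵐ ω : ℝ, IsRegularM (circlePt ω) A := by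
  unfold IsRegularM
  rw [Filter.eventually_all]
  intro a
  rw [Filter.eventually_all]
  exact fun b => ae_isRegularAt _

theorem eq_zero_of_ae_aeval_circlePt {q : ℝ[X]} (h : ∀ᵐ ω : ℝ, aeval (circlePt ω) q = 0) :
    q = 0 := by
  by_contra hq
  obtain ⟨ω, h1, h2⟩ := (h.and (ae_aeval_circlePt_ne_zero hq)).exists
  exact h2 h1

/-- The inequality |num| ≤ K |denom| holds on a dense closed set of frequencies, hence everywhere.
At a pole the numerator would vanish as well, against coprimality. -/
theorem isRegularAt_circlePt_of_bounded {K : ℝ} (h : ∀ᵐ ω : ℝ, ‖evalAt (circlePt ω) f‖ ≤ K)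
    (ω : ℝ) : IsRegularAt (circlePt ω) f := by
  have hdense : Dense {ω : ℝ | ‖aeval (circlePt ω) f.num‖ ≤ K * ‖aeval (circlePt ω) f.denom‖} := by
    refine Measure.dense_of_ae (μ := volume) ?_
    filter_upwards [h, ae_isRegularAt f] with ω h1 h2
    rwa [evalAt_eq, norm_div, div_le_iff₀ (norm_pos_iff.2 h2)] at h1
  have hclosed : IsClosed
      {ω : ℝ | ‖aeval (circlePt ω) f.num‖ ≤ K * ‖aeval (circlePt ω) f.denom‖} := by
    have := continuous_circlePt
    have hc : ∀ p : ℝ[X], Continuous fun ω => aeval (circlePt ω) p := fun p =>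
      (Polynomial.continuous_aeval p).comp this
    exact isClosed_le (hc _).norm (continuous_const.mul (hc _).norm)
  have hall := hclosed.closure_eq ▸ hdense.closure_eq
  intro h0
  have h1 : ω ∈ {ω : ℝ | ‖aeval (circlePt ω) f.num‖ ≤ K * ‖aeval (circlePt ω) f.denom‖} := by
    rw [hall]
    trivial
  rw [Set.mem_ofPred_eq, h0, norm_zero, mul_zero] at h1
  have h2 := norm_le_zero_iff.1 h1
  obtain ⟨u, v, huv⟩ := RatFunc.isCoprime_num_denom f
  have h3 := congrArg (aeval (circlePt ω)) huv
  simp [h0, h2] at h3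

/-- A stable proper rational function that agrees on the unit circle with the conjugate of a stable
proper rational function is constant. -/
theorem exists_eq_C_of_conj (hf : IsStable f) (hg : IsStable g) (hfp : IsProper f)
    (hgp : IsProper g)
    (h : ∀ᵐ ω : ℝ, evalAt (circlePt ω) f = (starRingEnd ℂ) (evalAt (circlePt ω) g)) :
    ∃ c, f = RatFunc.C c := by
  set d := g.denom.natDegree
  have hrefl : ∀ (p : ℝ[X]), p.natDegree ≤ d → ∀ ω, aeval (circlePt ω) (p.reflect d) *
      (starRingEnd ℂ (circlePt ω)) ^ d = starRingEnd ℂ (aeval (circlePt ω) p) := by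
    intro p hp ω
    have hz : circlePt ω ≠ 0 := by
      rw [← norm_pos_iff, norm_circlePt]
      exact one_pos
    have hconj : starRingEnd ℂ (circlePt ω) = (circlePt ω)⁻¹ := by
      rw [Complex.inv_def, Complex.normSq_eq_norm_sq, norm_circlePt]
      simp
    let _ : Invertible (starRingEnd ℂ (circlePt ω)) := invertibleOfNonzero (by simpa using hz)
    have h1 := eval₂_reflect_mul_pow (algebraMap ℝ ℂ) (starRingEnd ℂ (circlePt ω)) d p hp
    rw [invOf_eq_inv, hconj, inv_inv, ← hconj] at h1
    rw [aeval_def, h1, ← aeval_def, aeval_conj]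
  -- On the circle conjugation is z ↦ 1/z, so the conjugate of `g` is the quotient of the reflected
  -- polynomials. An equality at almost all frequencies is then one of polynomials.
  have hpoly : f.num * g.denom.reflect d = g.num.reflect d * f.denom := by
    rw [← sub_eq_zero]
    refine eq_zero_of_ae_aeval_circlePt ?_
    filter_upwards [h, ae_isRegularAt f, ae_isRegularAt g] with ω h1 h2 h3
    have h3' : starRingEnd ℂ (aeval (circlePt ω) g.denom) ≠ 0 := (_root_.map_ne_zero _).2 h3
    rw [evalAt_eq, evalAt_eq, map_div₀, div_eq_div_iff h2 h3', ← hrefl _ hgp, ← hrefl _ le_rfl,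
      ← mul_assoc, mul_right_comm _ _ (aeval (circlePt ω) f.denom)] at h1
    have hne : starRingEnd ℂ (circlePt ω) ^ d ≠ 0 := by
      refine pow_ne_zero _ ?_
      rw [← norm_pos_iff, RCLike.norm_conj, norm_circlePt]
      exact one_pos
    rw [map_sub, map_mul, map_mul, sub_eq_zero]
    exact mul_right_cancel₀ hne h1
  -- Every pole of `f` is thus the reciprocal of a pole of `g`, outside the disc, while stability
  -- puts it inside. The point 0 is no root, since the reversed denominator has a nonzero constant
  -- term.
  have hdvd : f.denom ∣ g.denom.reflect d :=
    (RatFunc.isCoprime_num_denom f).symm.dvd_of_dvd_mul_left ⟨g.num.reflect d, by rw [hpoly, mul_comm]⟩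
  have hdeg : f.denom.natDegree = 0 := by
    by_contra hne
    have hd : (f.denom.map (algebraMap ℝ ℂ)).degree ≠ 0 := by
      rw [degree_map]
      intro h0
      exact hne (natDegree_eq_of_degree_eq_some h0)
    obtain ⟨w, hw⟩ := Complex.exists_root (lt_of_le_of_ne
      (zero_le_degree_iff.2 (map_ne_zero f.denom_ne_zero)) hd.symm)
    have hw' : aeval w f.denom = 0 := by
      rwa [IsRoot, eval_map_algebraMap] at hw
    have hlt := hf w hw'
    have hr : aeval w (g.denom.reflect d) = 0 := by
      have := map_dvd (aeval w) hdvd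
      rwa [hw', zero_dvd_iff] at this
    by_cases hw0 : w = 0
    · subst hw0
      have : (g.denom.reverse).coeff 0 = 0 := by
        have h1 : aeval (0 : ℂ) g.denom.reverse = 0 := hr
        rw [aeval_def, eval₂_at_zero] at h1
        simpa using h1
      rw [coeff_zero_reverse] at this
      exact g.denom_ne_zero (leadingCoeff_eq_zero.1 this)
    · let _ : Invertible w⁻¹ := invertibleOfNonzero (inv_ne_zero hw0)
      have h1 := eval₂_reflect_eq_zero_iff (algebraMap ℝ ℂ) w⁻¹ d g.denom le_rfl
      rw [invOf_eq_inv, inv_inv] at h1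
      have h2 := hg w⁻¹ (h1.1 hr)
      rw [norm_inv] at h2
      have h3 : 0 < ‖w‖ := norm_pos_iff.2 hw0
      exact absurd h2 (not_lt.2 (one_le_inv₀ h3 |>.2 hlt.le))
  have h1 : f.denom = 1 := f.monic_denom.natDegree_eq_zero.1 hdeg
  have h2 : f.num.natDegree = 0 := by
    have := hfp
    rw [IsProper, hdeg] at this
    omega
  obtain ⟨c, hc⟩ := natDegree_eq_zero.1 h2
  refine ⟨c, ?_⟩
  rw [← RatFunc.num_div_denom f, h1, ← hc]
  simp

end Evaluation

end DynNet

/-! ### Uniqueness of spectral factors -/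

namespace DynNet

open MeasureTheory

section SpectralFactor

variable {ι : Type} [Fintype ι] [DecidableEq ι]

open scoped MatrixOrder in
theorem exists_eq_mul_transpose {Λ : Matrix ι ι ℝ} (h : Λ.PosSemidef) :
    ∃ B : Matrix ι ι ℝ, Λ = B * Bᵀ := by
  obtain ⟨B, hB⟩ := CStarAlgebra.nonneg_iff_eq_star_mul_self.1 h.nonneg
  refine ⟨Bᵀ, ?_⟩
  rw [hB, Matrix.transpose_transpose, Matrix.star_eq_conjTranspose,
    Matrix.conjTranspose_eq_transpose_of_trivial]

/-- `F` is stable and biproper with limit `F₀` at infinity, and its inverse has no pole outside the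
closed unit disc. -/
structure IsOuter (F : Matrix ι ι (RatFunc ℝ)) (F₀ : Matrix ι ι ℝ) : Prop where
  det_ne_zero : F.det ≠ 0
  stable : ∀ a b, IsStable (F a b)
  inv_regular : ∀ z : ℂ, 1 < ‖z‖ → IsRegularM z F⁻¹
  hasLim : HasLimM F F₀
  det_lim_ne_zero : F₀.det ≠ 0

variable {F F' : Matrix ι ι (RatFunc ℝ)} {F₀ F₀' : Matrix ι ι ℝ}

theorem map_C_mul {κ : Type*} [Fintype κ] (A B : Matrix κ κ ℝ) :
    (A * B).map RatFunc.C = A.map RatFunc.C * B.map (RatFunc.C : ℝ →+* RatFunc ℝ) :=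
  Matrix.map_mul

theorem map_C_one {κ : Type*} [DecidableEq κ] :
    (1 : Matrix κ κ ℝ).map RatFunc.C = (1 : Matrix κ κ (RatFunc ℝ)) :=
  Matrix.map_one _ (map_zero _) (map_one _)

theorem map_C_inv {B : Matrix ι ι ℝ} (hB : B.det ≠ 0) :
    (B.map RatFunc.C)⁻¹ = B⁻¹.map (RatFunc.C : ℝ →+* RatFunc ℝ) := by
  refine Matrix.inv_eq_right_inv ?_
  rw [← map_C_mul, Matrix.mul_nonsing_inv _ (isUnit_iff_ne_zero.2 hB), map_C_one]

theorem IsStable.isRegularAt {f : RatFunc ℝ} (h : IsStable f) {z : ℂ} (hz : 1 ≤ ‖z‖) :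
    IsRegularAt z f := fun h0 => absurd (h z h0) (not_lt.2 hz)

theorem IsOuter.mul_C (h : IsOuter F F₀) {B : Matrix ι ι ℝ} (hB : B.det ≠ 0) :
    IsOuter (F * B.map RatFunc.C) (F₀ * B) where
  det_ne_zero := by
    rw [Matrix.det_mul]
    exact mul_ne_zero h.det_ne_zero ((hasLimM_map_C B).det.ne_zero hB)
  stable := fun a b z h0 => by
    by_contra hz
    have h1 : IsRegularM z F := fun a b => (h.stable a b).isRegularAt (not_lt.1 hz)
    exact h1.mul (isRegularM_map_C z B) a b h0
  inv_regular := fun z hz => by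
    rw [Matrix.mul_inv_rev, map_C_inv hB]
    exact (isRegularM_map_C z _).mul (h.inv_regular z hz)
  hasLim := h.hasLim.mul (hasLimM_map_C B)
  det_lim_ne_zero := by
    rw [Matrix.det_mul]
    exact mul_ne_zero h.det_lim_ne_zero hB

theorem norm_le_one_of_mul_conjTranspose {Q : Matrix ι ι ℂ} (h : Q * Qᴴ = 1) (a b : ι) :
    ‖Q a b‖ ≤ 1 := by
  have h1 : (Q * Qᴴ) a a = 1 := by rw [h, Matrix.one_apply_eq]
  rw [Matrix.mul_apply] at h1
  simp only [Matrix.conjTranspose_apply, ← starRingEnd_apply, Complex.mul_conj] at h1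
  have h2 : ∑ k, Complex.normSq (Q a k) = 1 := by exact_mod_cast h1
  have h3 : Complex.normSq (Q a b) ≤ 1 := by
    rw [← h2]
    exact Finset.single_le_sum (f := fun k => Complex.normSq (Q a k))
      (fun k _ => Complex.normSq_nonneg _) (Finset.mem_univ b)
  rw [Complex.normSq_eq_norm_sq] at h3
  exact (sq_le_one_iff₀ (norm_nonneg _)).1 h3

/-- The quotient of two outer factors of the same spectrum is unitary on the unit circle. -/
theorem IsOuter.ae_unitary (h : IsOuter F F₀)
    (heq : ∀ᵐ ω : ℝ, F'.map (evalAt (circlePt ω)) * (F'.map (evalAt (circlePt ω)))ᴴ =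
      F.map (evalAt (circlePt ω)) * (F.map (evalAt (circlePt ω)))ᴴ) :
    ∀ᵐ ω : ℝ, (F⁻¹ * F').map (evalAt (circlePt ω)) *
      ((F⁻¹ * F').map (evalAt (circlePt ω)))ᴴ = 1 := by
  filter_upwards [heq, ae_isRegularM F, ae_isRegularM F⁻¹, ae_isRegularM F'] with ω h0 h1 h2 h3
  have h4 : F⁻¹.map (evalAt (circlePt ω)) * F.map (evalAt (circlePt ω)) = 1 := by
    rw [← map_evalAt_mul h2 h1, Matrix.nonsing_inv_mul _ (isUnit_iff_ne_zero.2 h.det_ne_zero),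
      map_evalAt_one]
  rw [map_evalAt_mul h2 h3, Matrix.conjTranspose_mul, Matrix.mul_assoc, ← Matrix.mul_assoc _ _
    (F⁻¹.map (evalAt (circlePt ω)))ᴴ, h0, Matrix.mul_assoc, ← Matrix.conjTranspose_mul, h4,
    Matrix.conjTranspose_one, Matrix.mul_one, h4]

/-- `F⁻¹` may have poles on the unit circle. They cancel in the quotient, which is unitary and hence
bounded there. -/
theorem IsOuter.isStable_inv_mul (h : IsOuter F F₀) (h' : IsOuter F' F₀')
    (heq : ∀ᵐ ω : ℝ, F'.map (evalAt (circlePt ω)) * (F'.map (evalAt (circlePt ω)))ᴴ =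
      F.map (evalAt (circlePt ω)) * (F.map (evalAt (circlePt ω)))ᴴ) (a b : ι) :
    IsStable ((F⁻¹ * F') a b) := by
  intro z hz
  by_contra hlt
  rcases (not_lt.1 hlt).eq_or_lt with h1 | h1
  · obtain ⟨ω, rfl⟩ := exists_circlePt h1.symm
    refine isRegularAt_circlePt_of_bounded (K := 1) ?_ ω hz
    filter_upwards [h.ae_unitary heq] with ω hω
    exact norm_le_one_of_mul_conjTranspose hω a b
  · exact (h.inv_regular z h1).mul (fun a b => (h'.stable a b).isRegularAt h1.le) a b hz

/-- Outer factors of the same spectrum differ by a constant orthogonal matrix. -/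
theorem IsOuter.exists_eq_mul_C (h : IsOuter F F₀) (h' : IsOuter F' F₀')
    (heq : ∀ᵐ ω : ℝ, F'.map (evalAt (circlePt ω)) * (F'.map (evalAt (circlePt ω)))ᴴ =
      F.map (evalAt (circlePt ω)) * (F.map (evalAt (circlePt ω)))ᴴ) :
    ∃ V : Matrix ι ι ℝ, F' = F * V.map RatFunc.C ∧ V * Vᵀ = 1 := by
  have hFF : F * F⁻¹ = 1 := Matrix.mul_nonsing_inv _ (isUnit_iff_ne_zero.2 h.det_ne_zero)
  have hFi : F'⁻¹ * F' = 1 := Matrix.nonsing_inv_mul _ (isUnit_iff_ne_zero.2 h'.det_ne_zero)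
  have hinv : (F'⁻¹ * F) * (F⁻¹ * F') = 1 := by
    rw [Matrix.mul_assoc, ← Matrix.mul_assoc F, hFF, Matrix.one_mul, hFi]
  have heq' := heq.mono fun ω hω => hω.symm
  -- The quotient and its inverse are both stable and proper, by symmetry, and unitarity makes each
  -- the conjugate transpose of the inverse of itself on the circle; so `exists_eq_C_of_conj`
  -- applies entrywise.
  have hconst : ∀ a b, ∃ c, (F⁻¹ * F') a b = RatFunc.C c := by
    intro a b
    refine exists_eq_C_of_conj (g := (F'⁻¹ * F) b a) (h.isStable_inv_mul h' heq a b)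
      (h'.isStable_inv_mul h heq' b a)
      (((h.hasLim.inv h.det_lim_ne_zero).mul h'.hasLim) a b).isProper
      (((h'.hasLim.inv h'.det_lim_ne_zero).mul h.hasLim) b a).isProper ?_
    filter_upwards [h'.ae_unitary heq', ae_isRegularM (F⁻¹ * F'), ae_isRegularM (F'⁻¹ * F)]
      with ω h1 h2 h3
    have h4 := map_evalAt_mul h3 h2
    rw [hinv, map_evalAt_one] at h4
    have h5 : (F⁻¹ * F').map (evalAt (circlePt ω)) =
        ((F'⁻¹ * F).map (evalAt (circlePt ω)))ᴴ := by
      rw [← Matrix.inv_eq_right_inv h1, Matrix.inv_eq_right_inv h4.symm]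
    exact congrFun (congrFun h5 a) b
  choose V hV using hconst
  have hVeq : F⁻¹ * F' = (Matrix.of V).map RatFunc.C := by
    ext a b
    exact hV a b
  refine ⟨Matrix.of V, ?_, ?_⟩
  · rw [← hVeq, ← Matrix.mul_assoc, hFF, Matrix.one_mul]
  · obtain ⟨ω, hω⟩ := (h.ae_unitary heq).exists
    rw [hVeq, map_evalAt_map_C] at hω
    have h1 : ((Matrix.of V).map (algebraMap ℝ ℂ))ᴴ = (Matrix.of V)ᵀ.map (algebraMap ℝ ℂ) := by
      ext a b
      simp
    rw [h1, ← Matrix.map_mul] at hω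
    have hinj : Function.Injective (algebraMap ℝ ℂ) := (algebraMap ℝ ℂ).injective
    exact Matrix.map_injective hinj
      (hω.trans (Matrix.map_one _ (map_zero _) (map_one _)).symm)

theorem map_ofReal_conjTranspose {κ : Type*} (B : Matrix κ κ ℝ) :
    (B.map (algebraMap ℝ ℂ))ᴴ = Bᵀ.map (algebraMap ℝ ℂ) := by
  ext a b
  simp

/-- Outer factors `W`, `W'` of the same full rank spectrum `W Λ W⋆ = W' Λ' W'⋆` differ by a constant
matrix. -/
theorem exists_eq_mul_C_of_spectrum_eq {W W' : Matrix ι ι (RatFunc ℝ)} {W₀ W₀' Λ Λ' : Matrix ι ι ℝ}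
    (h : IsOuter W W₀) (h' : IsOuter W' W₀') (hΛ : Λ.PosSemidef) (hΛ' : Λ'.PosSemidef)
    (hdet : Λ.det ≠ 0) (hdet' : Λ'.det ≠ 0)
    (heq : ∀ᵐ ω : ℝ, W.map (evalAt (circlePt ω)) * Λ.map (algebraMap ℝ ℂ) *
        (W.map (evalAt (circlePt ω)))ᴴ =
      W'.map (evalAt (circlePt ω)) * Λ'.map (algebraMap ℝ ℂ) *
        (W'.map (evalAt (circlePt ω)))ᴴ) :
    ∃ V : Matrix ι ι ℝ, W' = W * V.map RatFunc.C ∧ V * Λ' * Vᵀ = Λ := by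
  -- Absorbing the real factors of Λ = B Bᵀ and Λ' = B' B'ᵀ into `W` and `W'` reduces to identity
  -- covariance.
  obtain ⟨B, rfl⟩ := exists_eq_mul_transpose hΛ
  obtain ⟨B', rfl⟩ := exists_eq_mul_transpose hΛ'
  have hB : B.det ≠ 0 := fun h0 => hdet (by rw [Matrix.det_mul, h0, zero_mul])
  have hB' : B'.det ≠ 0 := fun h0 => hdet' (by rw [Matrix.det_mul, h0, zero_mul])
  have key : ∀ (W : Matrix ι ι (RatFunc ℝ)) (B : Matrix ι ι ℝ) (z : ℂ), IsRegularM z W →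
      (W * B.map RatFunc.C).map (evalAt z) * ((W * B.map RatFunc.C).map (evalAt z))ᴴ =
        W.map (evalAt z) * (B * Bᵀ).map (algebraMap ℝ ℂ) * (W.map (evalAt z))ᴴ := by
    intro W B z hW
    rw [map_evalAt_mul hW (isRegularM_map_C z B), map_evalAt_map_C, Matrix.conjTranspose_mul,
      map_ofReal_conjTranspose, Matrix.map_mul, Matrix.mul_assoc, Matrix.mul_assoc,
      Matrix.mul_assoc]
  obtain ⟨V, hV, hVV⟩ := (h.mul_C hB).exists_eq_mul_C (h'.mul_C hB') (by
    filter_upwards [heq, ae_isRegularM W, ae_isRegularM W'] with ω h1 h2 h3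
    rw [key _ _ _ h2, key _ _ _ h3, h1])
  have hBi : B' * B'⁻¹ = 1 := Matrix.mul_nonsing_inv _ (isUnit_iff_ne_zero.2 hB')
  have hBi' : B'⁻¹ * B' = 1 := Matrix.nonsing_inv_mul _ (isUnit_iff_ne_zero.2 hB')
  refine ⟨B * V * B'⁻¹, ?_, ?_⟩
  · have h1 : W' = W' * B'.map RatFunc.C * B'⁻¹.map RatFunc.C := by
      rw [Matrix.mul_assoc, ← map_C_mul, hBi, map_C_one, Matrix.mul_one]
    rw [h1, hV, map_C_mul, map_C_mul]
    simp only [Matrix.mul_assoc]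
  · have h1 : B * V * B'⁻¹ * (B' * B'ᵀ) * (B * V * B'⁻¹)ᵀ =
        B * (V * ((B'⁻¹ * B') * (B'⁻¹ * B')ᵀ) * Vᵀ) * Bᵀ := by
      simp only [Matrix.transpose_mul, Matrix.mul_assoc]
    rw [h1, hBi', Matrix.transpose_one, Matrix.mul_one, Matrix.mul_one, hVV, Matrix.mul_one]

end SpectralFactor

/-! ### Triangular congruences -/

section Triangular

variable {ι α : Type*} [Fintype ι] [LinearOrder α] {K : Type*} [Field K]
  {b : ι → α}

theorem BlockTriangular.mul_apply_diag (hb : b.Injective) {A B : Matrix ι ι K}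
    (hA : A.BlockTriangular b) (hB : B.BlockTriangular b) (a : ι) :
    (A * B) a a = A a a * B a a := by
  rw [Matrix.mul_apply]
  refine Finset.sum_eq_single a (fun k _ hk => ?_) (fun h => absurd (Finset.mem_univ a) h)
  rcases lt_trichotomy (b k) (b a) with h | h | h
  · rw [hA h, zero_mul]
  · exact absurd (hb h) hk
  · rw [hB h, mul_zero]

variable [DecidableEq ι]

theorem BlockTriangular.inv_blockTriangular {A : Matrix ι ι K} (hA : A.BlockTriangular b)
    (hdet : A.det ≠ 0) : A⁻¹.BlockTriangular b := by
  have := A.invertibleOfIsUnitDet (isUnit_iff_ne_zero.2 hdet)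
  exact Matrix.blockTriangular_inv_of_blockTriangular hA

theorem BlockTriangular.inv_apply_diag (hb : b.Injective) {A : Matrix ι ι K}
    (hA : A.BlockTriangular b) (hdet : A.det ≠ 0) (hdiag : ∀ a, A a a = 1) (a : ι) :
    A⁻¹ a a = 1 := by
  have h := BlockTriangular.mul_apply_diag hb hA (BlockTriangular.inv_blockTriangular hA hdet) a
  rw [Matrix.mul_nonsing_inv _ (isUnit_iff_ne_zero.2 hdet), Matrix.one_apply_eq, hdiag,
    one_mul] at h
  exact h.symm

/-- A unit triangular congruence between nonsingular diagonal matrices is trivial. -/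
theorem eq_one_of_blockTriangular_congr (hb : b.Injective) {V D D' : Matrix ι ι K}
    (hV : V.BlockTriangular b) (hdiag : ∀ a, V a a = 1) (hdet : V.det ≠ 0) (hD : D.IsDiag)
    (hD' : D'.IsDiag) (hD'det : D'.det ≠ 0) (h : V * D' * Vᵀ = D) : V = 1 := by
  have hVi := BlockTriangular.inv_blockTriangular hV hdet
  -- The left side is triangular one way, the right side the other way, so both are diagonal.
  have h1 : V * D' = D * V⁻¹ᵀ := by
    rw [← h, Matrix.mul_assoc _ Vᵀ, ← Matrix.transpose_mul,
      Matrix.nonsing_inv_mul _ (isUnit_iff_ne_zero.2 hdet), Matrix.transpose_one, Matrix.mul_one]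
  have hne : ∀ k, D' k k ≠ 0 := by
    intro k h0
    apply hD'det
    rw [← hD'.diagonal_diag, Matrix.det_diagonal]
    exact Finset.prod_eq_zero (Finset.mem_univ k) h0
  ext k l
  by_cases hkl : k = l
  · subst hkl
    rw [hdiag, Matrix.one_apply_eq]
  rw [Matrix.one_apply_ne hkl]
  rcases lt_trichotomy (b l) (b k) with hlt | heq | hlt
  · exact hV hlt
  · exact absurd (hb heq).symm hkl
  · have h2 := congrFun (congrFun h1 k) l
    rw [← hD'.diagonal_diag, ← hD.diagonal_diag, Matrix.mul_diagonal, Matrix.diagonal_mul,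
      Matrix.transpose_apply, hVi hlt, mul_zero] at h2
    exact (mul_eq_zero.1 h2).resolve_right (hne l)

end Triangular

end DynNet

/-! ### From the data to the module -/

namespace DynNet

open MeasureTheory

namespace ModelSet

variable {L n : ℕ} {M : ModelSet L n} {θ θ₀ θ₁ : Fin n → ℝ}

theorem IsWellPosed.det_one_sub_Ginfty_ne_zero (hM : M.IsWellPosed) (hθ : θ ∈ M.Θ) :
    (1 - M.Ginfty θ).det ≠ 0 := by
  have h := hM.principal_minors θ hθ Finset.univ
  have e := Matrix.det_submatrix_equiv_self (Equiv.subtypeUnivEquiv fun x : Fin L =>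
    Finset.mem_univ x) (1 - M.Ginfty θ)
  rw [← e]
  exact h

theorem IsWellPosed.hasLimM_one_sub_G (hM : M.IsWellPosed) (hθ : θ ∈ M.Θ) :
    HasLimM (1 - M.G θ) (1 - M.Ginfty θ) := fun a b => by
  rw [Matrix.sub_apply, Matrix.sub_apply, sub_eq_add_neg, sub_eq_add_neg]
  exact (hasLimM_one a b).add (hM.G_proper θ hθ a b).hasLim.neg

theorem IsWellPosed.isUnit_det (hM : M.IsWellPosed) (hθ : θ ∈ M.Θ) : IsUnit (1 - M.G θ).det :=
  isUnit_iff_ne_zero.2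
    ((hM.hasLimM_one_sub_G hθ).det.ne_zero (hM.det_one_sub_Ginfty_ne_zero hθ))

theorem IsWellPosed.hasLimM_T (hM : M.IsWellPosed) (hθ : θ ∈ M.Θ) :
    HasLimM (M.T θ) (1 - M.Ginfty θ)⁻¹ :=
  (hM.hasLimM_one_sub_G hθ).inv (hM.det_one_sub_Ginfty_ne_zero hθ)

/-- The limit of `C T [H; 0]` at infinity. -/
def CTHinfty (M : ModelSet L n) (θ : Fin n → ℝ) : Matrix M.measured M.measured ℝ :=
  (1 - M.Ginfty θ)⁻¹.submatrix Subtype.val Subtype.val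

theorem IsWellPosed.hasLimM_CTH (hM : M.IsWellPosed) (hθ : θ ∈ M.Θ) :
    HasLimM (M.CTH θ) (M.CTHinfty θ) := by
  have hnoise : HasLimM (M.noise θ)
      (Matrix.of fun (w : Fin L) (k : M.measured) => if w = k then (1 : ℝ) else 0) := by
    intro w k
    by_cases hw : w ∈ M.measured
    · have h1 : M.noise θ w k = M.H θ ⟨w, hw⟩ k := M.X_inr_of_mem hw k
      have h2 := (hM.H_proper θ hθ ⟨w, hw⟩ k).hasLim
      have h3 : atInfty (M.H θ ⟨w, hw⟩ k) = (1 : Matrix M.measured M.measured ℝ) ⟨w, hw⟩ k := by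
        rw [← hM.H_monic θ hθ]
        rfl
      rw [h1, Matrix.of_apply]
      rw [h3, Matrix.one_apply] at h2
      simpa [Subtype.ext_iff] using h2
    · have h1 : M.noise θ w k = 0 := M.X_inr_of_notMem hw k
      have h2 : w ≠ k := fun h => hw (h ▸ k.2)
      rw [h1, Matrix.of_apply, if_neg h2]
      exact hasLim_zero
  intro a b
  have h := ((hM.hasLimM_T hθ).mul hnoise) a b
  have hb : ((1 - M.Ginfty θ)⁻¹ * Matrix.of fun (w : Fin L) (k : M.measured) =>
      if w = k then (1 : ℝ) else 0) a b = M.CTHinfty θ a b := by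
    simp [Matrix.mul_apply, CTHinfty]
  rw [hb] at h
  exact h

/-- By the complementary minor identity, this determinant is the principal minor of I - G^∞ on the
unmeasured signals divided by det(I - G^∞). -/
theorem IsWellPosed.det_CTHinfty_ne_zero (hM : M.IsWellPosed) (hθ : θ ∈ M.Θ) :
    (M.CTHinfty θ).det ≠ 0 := by
  have h := det_mul_det_inv_submatrix (1 - M.Ginfty θ) (hM.det_one_sub_Ginfty_ne_zero hθ)
    (fun k => k ∈ M.measured)
  have h1 := hM.principal_minors θ hθ M.measuredᶜ
  have e := Matrix.det_submatrix_equiv_self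
    (Equiv.subtypeEquivRight fun x : Fin L => (Finset.mem_compl (s := M.measured) (a := x)))
    ((1 - M.Ginfty θ).submatrix (Subtype.val : {a // ¬ a ∈ M.measured} → Fin L) Subtype.val)
  have h' : (1 - M.Ginfty θ).det * (M.CTHinfty θ).det =
      ((1 - M.Ginfty θ).submatrix (Subtype.val : {a // ¬ a ∈ M.measured} → Fin L)
        Subtype.val).det := by
    convert h <;> rfl
  intro h0
  rw [h0, mul_zero, ← e] at h'
  exact h1 h'.symm

theorem IsWellPosed.isOuter_CTH (hM : M.IsWellPosed) (hphase : M.HasMinimumPhaseSpectralFactor)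
    (hθ : θ ∈ M.Θ) : IsOuter (M.CTH θ) (M.CTHinfty θ) where
  det_ne_zero := (hphase θ hθ).1.ne_zero
  stable := (hphase θ hθ).2.1
  inv_regular := fun z hz a b h0 => absurd ((hphase θ hθ).2.2 a b z h0) (not_le.2 hz)
  hasLim := hM.hasLimM_CTH hθ
  det_lim_ne_zero := hM.det_CTHinfty_ne_zero hθ

theorem ae_measuredSpectrum_eq (M : ModelSet L n) (θ : Fin n → ℝ) :
    ∀ᵐ ω : ℝ, M.measuredSpectrum θ ω = (M.CTH θ).map (evalAt (circlePt ω)) *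
      (M.Λ θ).map (algebraMap ℝ ℂ) * ((M.CTH θ).map (evalAt (circlePt ω)))ᴴ := by
  filter_upwards [ae_isRegularM (M.T θ), ae_isRegularM (M.noise θ)] with ω h1 h2
  have h3 : M.Φ θ ω = (M.T θ * M.noise θ).map (evalAt (circlePt ω)) *
      (M.Λ θ).map (algebraMap ℝ ℂ) * ((M.T θ * M.noise θ).map (evalAt (circlePt ω)))ᴴ := by
    rw [map_evalAt_mul h1 h2, Matrix.conjTranspose_mul, ← Matrix.mul_assoc]
    rfl
  rw [measuredSpectrum, h3]
  rfl

theorem det_Λ_ne_zero (hfull : M.HasFullRankSpectrum) (hθ : θ ∈ M.Θ) : (M.Λ θ).det ≠ 0 := by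
  obtain ⟨ω, h1, h2⟩ := ((hfull θ hθ).and (M.ae_measuredSpectrum_eq θ)).exists
  rw [h2] at h1
  have h3 : Fintype.card M.measured ≤ ((M.Λ θ).map (algebraMap ℝ ℂ)).rank := by
    rw [← h1]
    exact (Matrix.rank_mul_le_left _ _).trans (Matrix.rank_mul_le_right _ _)
  have h4 := det_ne_zero_of_card_le_rank h3
  intro h0
  apply h4
  have := RingHom.map_det (algebraMap ℝ ℂ) (M.Λ θ)
  rw [h0, map_zero] at this
  exact this.symm

/-- The factors differ by a constant V, which is read off at infinity. If G is strictly proper, both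
limits are 1. Otherwise both are unit triangular in a common order, so V is too, and its congruence
between diagonal covariances makes it trivial. -/
theorem CTH_eq_of_spectrum_eq (hM : M.IsWellPosed) (hfull : M.HasFullRankSpectrum)
    (hphase : M.HasMinimumPhaseSpectralFactor) (hfeed : M.HasFeedthroughCondition)
    (h₀ : θ₀ ∈ M.Θ) (h₁ : θ₁ ∈ M.Θ)
    (hΦ : ∀ ω : ℝ, M.measuredSpectrum θ₀ ω = M.measuredSpectrum θ₁ ω) : M.CTH θ₀ = M.CTH θ₁ := by
  have ho₀ := hM.isOuter_CTH hphase h₀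
  have ho₁ := hM.isOuter_CTH hphase h₁
  obtain ⟨V, hV, hVΛ⟩ := exists_eq_mul_C_of_spectrum_eq ho₀ ho₁ (hM.Λ_posSemidef θ₀ h₀)
    (hM.Λ_posSemidef θ₁ h₁) (det_Λ_ne_zero hfull h₀) (det_Λ_ne_zero hfull h₁) (by
      filter_upwards [M.ae_measuredSpectrum_eq θ₀, M.ae_measuredSpectrum_eq θ₁] with ω e₀ e₁
      rw [← e₀, ← e₁, hΦ])
  have hlim : M.CTHinfty θ₁ = M.CTHinfty θ₀ * V :=
    ho₁.hasLim.unique (hV ▸ ho₀.hasLim.mul (hasLimM_map_C V))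
  suffices h : V = 1 by
    rw [hV, h, map_C_one, Matrix.mul_one]
  rcases hfeed with hstrict | ⟨hdiag, σ, hσ⟩
  · have key : ∀ θ ∈ M.Θ, M.CTHinfty θ = 1 := by
      intro θ hθ
      rw [CTHinfty, hstrict θ hθ, sub_zero, inv_one]
      exact Matrix.submatrix_one _ Subtype.val_injective
    rw [key _ h₀, key _ h₁, Matrix.one_mul] at hlim
    exact hlim.symm
  · let b : Fin L → (Fin L)ᵒᵈ := fun k => OrderDual.toDual (σ.symm k)
    have hb : b.Injective := fun k l h => σ.symm.injective h
    have hb' : (b ∘ (Subtype.val : M.measured → Fin L)).Injective :=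
      hb.comp Subtype.val_injective
    have key : ∀ θ ∈ M.Θ, (M.CTHinfty θ).BlockTriangular (b ∘ Subtype.val) ∧
        ∀ a, M.CTHinfty θ a a = 1 := by
      intro θ hθ
      have h1 : (1 - M.Ginfty θ).BlockTriangular b := by
        refine Matrix.blockTriangular_one.sub fun k l hkl => ?_
        have := hσ θ hθ (σ.symm k) (σ.symm l) hkl
        rwa [Equiv.apply_symm_apply, Equiv.apply_symm_apply] at this
      have h2 : ∀ k, (1 - M.Ginfty θ) k k = 1 := by
        intro k
        have : M.Ginfty θ k k = 0 := by
          change atInfty (M.G θ k k) = 0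
          rw [hM.G_hollow θ hθ, atInfty, RatFunc.num_zero, Polynomial.coeff_zero]
        rw [Matrix.sub_apply, this, Matrix.one_apply_eq, sub_zero]
      have hdet := hM.det_one_sub_Ginfty_ne_zero hθ
      exact ⟨(BlockTriangular.inv_blockTriangular h1 hdet).submatrix,
        fun a => BlockTriangular.inv_apply_diag hb h1 hdet h2 a⟩
    obtain ⟨t₀, d₀⟩ := key _ h₀
    obtain ⟨t₁, d₁⟩ := key _ h₁
    have hdet₀ := ho₀.det_lim_ne_zero
    have hVeq : V = (M.CTHinfty θ₀)⁻¹ * M.CTHinfty θ₁ := by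
      rw [hlim, ← Matrix.mul_assoc, Matrix.nonsing_inv_mul _ (isUnit_iff_ne_zero.2 hdet₀),
        Matrix.one_mul]
    have ti := BlockTriangular.inv_blockTriangular t₀ hdet₀
    refine eq_one_of_blockTriangular_congr hb' (hVeq ▸ ti.mul t₁) (fun a => ?_) ?_
      (hdiag _ h₀) (hdiag _ h₁) (det_Λ_ne_zero hfull h₁) hVΛ
    · rw [hVeq, BlockTriangular.mul_apply_diag hb' ti t₁,
        BlockTriangular.inv_apply_diag hb' t₀ hdet₀ d₀, d₁, one_mul]
    · intro h0
      apply ho₁.det_lim_ne_zero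
      rw [hlim, Matrix.det_mul, h0, mul_zero]

/-- The spectrum and the map from the excitations determine the responses of the measured signals to
all external signals. -/
theorem response_eq_of_measured (hR : M.CTR θ₀ = M.CTR θ₁) (hH : M.CTH θ₀ = M.CTH θ₁)
    (A : Set M.Ext) {k : Fin L} (hk : k ∈ M.measured) :
    M.response θ₀ A k = M.response θ₁ A k := by
  have h : ∀ θ (x : M.Ext), (M.T θ * M.X θ) k x =
      Sum.elim (M.CTR θ ⟨k, hk⟩) (M.CTH θ ⟨k, hk⟩) x := by
    intro θ x
    rw [X, Matrix.mul_fromCols]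
    rcases x with x | x <;> rfl
  funext x
  rw [response, response, h, h, hR, hH]

theorem response_eq_add (hdet : IsUnit (1 - M.G θ).det) (A : Set M.Ext) (k : Fin L) :
    M.response θ A k = ∑ l, M.G θ k l • M.response θ A l + fun x : A => M.X θ k x := by
  have h : M.T θ * M.X θ = M.G θ * (M.T θ * M.X θ) + M.X θ := by
    have h1 : (1 - M.G θ) * (M.T θ * M.X θ) = M.X θ := by
      rw [T, ← Matrix.mul_assoc, Matrix.mul_nonsing_inv _ hdet, Matrix.one_mul]
    rw [Matrix.sub_mul, Matrix.one_mul, sub_eq_iff_eq_add'] at h1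
    exact h1
  funext x
  have h2 := congrFun (congrFun h k) (x : M.Ext)
  rw [Matrix.add_apply, Matrix.mul_apply] at h2
  rw [Pi.add_apply, Finset.sum_apply]
  exact h2

theorem G_eq_zero_of_notMem_inNbrs {k l : Fin L} (h : l ∉ M.inNbrs k) (hθ : θ ∈ M.Θ) :
    M.G θ k l = 0 := by
  have h1 : ¬ M.graph.Adj (Sum.inl l) (Sum.inl k) := h
  rw [graph_adj_inl, not_not] at h1
  exact h1 θ hθ

/-- If the response of `w i` is independent of the responses of the signals in `B`, which contains the
in-neighbors of `w i` and those in-neighbors of `w j` other than `w i` that are not measured with a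
known edge, then `G j i` is determined. -/
theorem G_eq_of_dual {i j : Fin L} (hdet₀ : IsUnit (1 - M.G θ₀).det)
    (hdet₁ : IsUnit (1 - M.G θ₁).det) (h₀ : θ₀ ∈ M.Θ) (h₁ : θ₁ ∈ M.Θ) {A : Set M.Ext}
    (hmeas : ∀ k ∈ M.measured, M.response θ₀ A k = M.response θ₁ A k) (hj : j ∈ M.measured)
    (hXi : ∀ x ∈ A, M.X θ₀ i x = M.X θ₁ i x) (hXj : ∀ x ∈ A, M.X θ₀ j x = M.X θ₁ j x)
    (φ : (A → RatFunc ℝ) →ₗ[RatFunc ℝ] RatFunc ℝ)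
    (hφi : φ (M.response θ₀ A i) ≠ 0)
    (hφ : ∀ k ∈ M.inNbrs i ∪ (M.inNbrsMinus j \ {i}),
      φ (M.response θ₀ A k) = 0 ∧ φ (M.response θ₁ A k) = 0) :
    M.G θ₀ j i = M.G θ₁ j i := by
  have hrow : ∀ θ, IsUnit (1 - M.G θ).det → ∀ k, φ (M.response θ A k) =
      ∑ l, M.G θ k l * φ (M.response θ A l) + φ fun x : A => M.X θ k x := by
    intro θ hdet k
    have h := congrArg φ (response_eq_add hdet A k)
    simpa only [map_add, map_sum, map_smul, smul_eq_mul] using h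
  have hXi' : (fun x : A => M.X θ₀ i x) = fun x : A => M.X θ₁ i x := funext fun x => hXi x x.2
  have hXj' : (fun x : A => M.X θ₀ j x) = fun x : A => M.X θ₁ j x := funext fun x => hXj x x.2
  have hzero : ∀ θ ∈ M.Θ, (∀ k ∈ M.inNbrs i, φ (M.response θ A k) = 0) →
      ∑ l, M.G θ i l * φ (M.response θ A l) = 0 := by
    intro θ hθ h
    refine Finset.sum_eq_zero fun l _ => ?_
    by_cases hl : l ∈ M.inNbrs i
    · rw [h l hl, mul_zero]
    · rw [G_eq_zero_of_notMem_inNbrs hl hθ, zero_mul]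
  -- Since φ kills all in-neighbors of `w i`, only φ of the row of X at `w i` is left, and that row
  -- is common to both models.
  have hi : φ (M.response θ₀ A i) = φ (M.response θ₁ A i) := by
    rw [hrow _ hdet₀, hrow _ hdet₁, hzero _ h₀ fun k hk => (hφ k (Or.inl hk)).1,
      hzero _ h₁ fun k hk => (hφ k (Or.inl hk)).2, hXi']
  have hsum : ∑ l, M.G θ₀ j l * φ (M.response θ₀ A l) =
      ∑ l, M.G θ₁ j l * φ (M.response θ₁ A l) := by
    have h := congrArg φ (hmeas j hj)
    rw [hrow _ hdet₀, hrow _ hdet₁, hXj'] at h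
    exact add_right_cancel h
  rw [← Finset.add_sum_erase _ _ (Finset.mem_univ i),
    ← Finset.add_sum_erase _ _ (Finset.mem_univ i)] at hsum
  -- Measured in-neighbors with a known edge have equal entries and equal responses in both models;
  -- all other terms vanish.
  have hrest : ∑ l ∈ Finset.univ.erase i, M.G θ₀ j l * φ (M.response θ₀ A l) =
      ∑ l ∈ Finset.univ.erase i, M.G θ₁ j l * φ (M.response θ₁ A l) := by
    refine Finset.sum_congr rfl fun l hl => ?_
    have hli := Finset.ne_of_mem_erase hl
    by_cases hlj : l ∈ M.inNbrs j
    · by_cases hlm : l ∈ M.measured ∧ M.KnownEdge (Sum.inl l) j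
      · obtain ⟨c, hc⟩ := hlm.2.2
        have e₀ : M.G θ₀ j l = c := hc θ₀ h₀
        have e₁ : M.G θ₁ j l = c := hc θ₁ h₁
        rw [e₀, e₁, hmeas l hlm.1]
      · have h := hφ l (Or.inr ⟨⟨hlj, hlm⟩, hli⟩)
        rw [h.1, h.2, mul_zero, mul_zero]
    · rw [G_eq_zero_of_notMem_inNbrs hlj h₀, G_eq_zero_of_notMem_inNbrs hlj h₁, zero_mul, zero_mul]
  rw [hrest, ← hi] at hsum
  exact mul_right_cancel₀ hφi (add_right_cancel hsum)

end ModelSet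

end DynNet

end

/-! ### Generic identifiability -/

theorem mainTheorem11 {L n : ℕ} (M : DynNet.ModelSet L n)
    (hM : M.IsWellPosed)
    (hfull : M.HasFullRankSpectrum)
    (hphase : M.HasMinimumPhaseSpectralFactor)
    (hind : M.IsIndependentlyParameterized)
    (hfeed : M.HasFeedthroughCondition)
    (hfix : M.HasRegularFixedEntries)
    (i j : Fin L) (hj : j ∈ M.measured) (hi : i ∉ M.measured)
    (xi : M.Ext) (hdeg : M.outDegree (Sum.inr xi) = 1) (hxi : M.KnownEdge (Sum.inr xi) i)
    (Xbar : Set M.Ext) (hX : Xbar ⊆ M.extNoUnknown j \ {xi})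
    (Cbar : Set (Fin L)) (hC : Cbar ⊆ (M.measured : Set (Fin L)))
    (h1 : M.b (Xbar ∪ {xi}) (M.inNbrs i ∪ M.inNbrsMinus j ∪ Cbar) =
      1 + M.b (Xbar ∪ {xi}) (M.inNbrs i ∪ (M.inNbrsMinus j \ {i}) ∪ Cbar))
    (h2 : M.b (Xbar ∪ {xi}) (M.inNbrs i ∪ (M.inNbrsMinus j \ {i}) ∪ Cbar) =
      M.b (Xbar ∪ {xi}) Cbar) :
    M.GenericallyIdentifiable j i := by
  have hdet : ∀ θ ∈ M.Θ, IsUnit (1 - M.G θ).det := fun θ hθ => hM.isUnit_det hθ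
  set A := Xbar ∪ {xi} with hA
  set B := M.inNbrs i ∪ (M.inNbrsMinus j \ {i}) ∪ Cbar with hB
  set B' := M.inNbrs i ∪ M.inNbrsMinus j ∪ Cbar with hB'
  have hae : ∀ᵐ θ, θ ∈ M.Θ → M.IdentifiableAt j i θ := by
    filter_upwards [DynNet.ModelSet.ae_le_responseRank hM hind hfix hdet A B',
      DynNet.ModelSet.ae_le_responseRank hM hind hfix hdet A Cbar] with θ₀ g1 g2 h₀ θ₁ h₁ hR hΦ
    specialize g1 h₀
    specialize g2 h₀
    have hH := DynNet.ModelSet.CTH_eq_of_spectrum_eq hM hfull hphase hfeed h₀ h₁ hΦ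
    have hmeas : ∀ k ∈ M.measured, M.response θ₀ A k = M.response θ₁ A k := fun k hk =>
      DynNet.ModelSet.response_eq_of_measured hR hH A hk
    have u0 := DynNet.ModelSet.responseRank_le h₀ (hdet θ₀ h₀) A B
    have u1 := DynNet.ModelSet.responseRank_le h₁ (hdet θ₁ h₁) A B
    -- Otherwise adding `i` to `B` would not raise the rank, against condition 1 and the generic
    -- rank of `B'`.
    have hnot : M.response θ₀ A i ∉ Submodule.span (RatFunc ℝ) (M.response θ₀ A '' B) := by
      intro hmem
      have hle : M.responseRank θ₀ A B' ≤ M.responseRank θ₀ A B := by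
        refine Submodule.finrank_mono (Submodule.span_le.2 ?_)
        rintro _ ⟨k, hk, rfl⟩
        by_cases hki : k = i
        · rw [hki]
          exact hmem
        · refine Submodule.subset_span ⟨k, ?_, rfl⟩
          rcases hk with (hk | hk) | hk
          · exact Or.inl (Or.inl hk)
          · exact Or.inl (Or.inr ⟨hk, hki⟩)
          · exact Or.inr hk
      omega
    obtain ⟨φ, hφi, hφ⟩ := Submodule.exists_le_ker_of_notMem hnot
    have hφ₀ : ∀ k ∈ B, φ (M.response θ₀ A k) = 0 := fun k hk =>
      hφ (Submodule.subset_span ⟨k, hk, rfl⟩)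
    have hCeq : M.response θ₁ A '' Cbar = M.response θ₀ A '' Cbar :=
      Set.image_congr fun k hk => (hmeas k (hC hk)).symm
    -- At θ₁ only the upper bound is available: rank of `B` at θ₁ ≤ b(A, B) = b(A, C̄) ≤ rank of C̄
    -- at θ₀, and the responses of C̄ agree in both models.
    have hspan : Submodule.span (RatFunc ℝ) (M.response θ₁ A '' Cbar) =
        Submodule.span (RatFunc ℝ) (M.response θ₁ A '' B) := by
      refine Submodule.eq_of_le_of_finrank_le
        (Submodule.span_mono (Set.image_mono Set.subset_union_right)) ?_
      rw [hCeq]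
      change M.responseRank θ₁ A B ≤ M.responseRank θ₀ A Cbar
      omega
    have hφ₁ : ∀ k ∈ B, φ (M.response θ₁ A k) = 0 := by
      intro k hk
      have hmem : M.response θ₁ A k ∈ Submodule.span (RatFunc ℝ) (M.response θ₁ A '' B) :=
        Submodule.subset_span ⟨k, hk, rfl⟩
      rw [← hspan, hCeq] at hmem
      exact hφ (Submodule.span_mono (Set.image_mono Set.subset_union_right) hmem)
    have hXi : ∀ x, M.X θ₀ i x = M.X θ₁ i x := by
      rintro (x | x)
      · rfl
      · rw [M.X_inr_of_notMem hi, M.X_inr_of_notMem hi]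
    -- Noise does not enter the unmeasured `w i`, so `xi` is an excitation, whose column is the unit
    -- vector at `i ≠ j`.
    have hXxi : ∀ θ, M.X θ j xi = 0 := by
      intro θ
      have hne := DynNet.ModelSet.graph_adj_inl.1 hxi.1
      rcases xi with r | e
      · have hr : i = r := by
          by_contra hir
          exact hne fun θ _ => (M.X_inl i r).trans (if_neg hir)
        rw [M.X_inl, if_neg]
        rintro hjr
        exact hi (hr.trans hjr.symm ▸ hj)
      · exact absurd (fun θ _ => M.X_inr_of_notMem hi e) hne
    refine DynNet.ModelSet.G_eq_of_dual (hdet _ h₀) (hdet _ h₁) h₀ h₁ hmeas hj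
      (fun x _ => hXi x) ?_ φ hφi fun k hk => ⟨hφ₀ k (Or.inl hk), hφ₁ k (Or.inl hk)⟩
    rintro x (hx | rfl)
    · have hx' : ¬ M.UnknownEdge (Sum.inr x) j := (hX hx).1
      by_cases hfixed : DynNet.IsFixed M.Θ (M.entry j (Sum.inr x))
      · obtain ⟨c, hc⟩ := hfixed
        exact (hc θ₀ h₀).trans (hc θ₁ h₁).symm
      · have hadj : DynNet.IsFixedZero M.Θ (M.entry j (Sum.inr x)) := by
          by_contra hcon
          exact hx' ⟨DynNet.ModelSet.graph_adj_inl.2 hcon, hfixed⟩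
        exact absurd ⟨0, hadj⟩ hfixed
    · rw [hXxi, hXxi]
  rw [MeasureTheory.ae_iff] at hae
  refine MeasureTheory.measure_mono_null ?_ hae
  rintro θ ⟨hθ, hn⟩
  exact fun h => hn (h hθ)
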